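/- Fix an integer $l\ge 3$. **Notation.** A finite interval is $I=[n+1,n+m]\subset\mathbb Z$ with $m\ge 1$; put $\widetilde I=[n+1,n+m+1]$ and let $\mathcal M_I^\times$ be the set of subsets of $\widetilde I$ other than $\emptyset$ and $\widetilde I$. A Maya diagram of charge $r\in\mathbb Z$ is a set $\mathbf k\subset\mathbb Z$ for which there are integers $p,q\ge 0$ with $\mathbb Z_{\le r-p}\subset\mathbf k\subset\mathbb Z_{\le r+q}$ and $|\mathbf k\cap\mathbb Z_{>r-p}|=p$; $\mathcal M_{\mathbb Z}$ is the set of all Maya diagrams. Let $\mathcal M_{\mathbb Z}(I)$ be the set of $\mathbf k=\mathbb Z_{\le n}\cup\mathbf k_I$ with $\mathbf k_I\in\mathcal M_I^\times$, and let $\mathrm{res}_I:\mathcal M_{\mathbb Z}(I)\to\mathcal M_I^\times$, $\mathbf k\mapsto\mathbf k_I$ (a bijection), and $\Omega_I(\mathbf k)=\mathrm{res}_I^{-1}(\widetilde I\setminus\mathrm{res}_I(\mathbf k))$. **BZ data.** An $e$-BZ datum associated to $I$ is a family of integers $(M_{\mathbf k})_{\mathbf k\in\mathcal M_I^\times}$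 such that, with $M_\emptyset=M_{\widetilde I}=0$: (0) $M_{[n+1,i]}=0$ for all $i\in I$; (1) $M_{\mathbf k\cup\{i\}}+M_{\mathbf k\cup\{j\}}\le M_{\mathbf k\cup\{i,j\}}+M_{\mathbf k}$ for all $i\ne j$ in $\widetilde I$ and $\mathbf k\subset\widetilde I\setminus\{i,j\}$; (2) $M_{\mathbf k\cup\{i,k\}}+M_{\mathbf k\cup\{j\}}=\min\{M_{\mathbf k\cup\{i,j\}}+M_{\mathbf k\cup\{k\}},\,M_{\mathbf k\cup\{j,k\}}+M_{\mathbf k\cup\{i\}}\}$ for all $i<j<k$ in $\widetilde I$ and $\mathbf k\subset\widetilde I\setminus\{i,j,k\}$. An $e$-BZ datum associated to $\mathbb Z$ is a family of integers $\mathbf M=(M_{\mathbf k})_{\mathbf k\in\mathcal M_{\mathbb Z}}$ such that (a) for every finite interval $K$ the family $(M_{\mathrm{res}_K^{-1}(\mathbf s)})_{\mathbf s\in\mathcal M_K^\times}$ is an $e$-BZ datum associated to $K$; (b) for every $\mathbf k\in\mathcal M_{\mathbb Z}$ there is a finite interval $I$ with $\mathbf k\in\mathcal M_{\mathbb Z}(I)$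 and $M_{\Omega_J(\mathbf k)}=M_{\Omega_I(\mathbf k)}$ for all finite intervals $J\supset I$. Let $\mathcal{BZ}^e_{\mathbb Z}$ be the set of these, $\sigma(\mathbf M)_{\mathbf k}=M_{\mathbf k-l}$ with $\mathbf k-l=\{x-l\mid x\in\mathbf k\}$, and $(\mathcal{BZ}^e_{\mathbb Z})^\sigma=\{\mathbf M\in\mathcal{BZ}^e_{\mathbb Z}\mid\sigma(\mathbf M)=\mathbf M\}$. **Lusztig data.** $\mathcal B_{\mathbb Z}$ is the set of families $\mathbf a=(a_{i,j})_{i<j}$, $i,j\in\mathbb Z$, of nonnegative integers for which there is $N>0$ with $a_{i,j}=0$ whenever $j-i\ge N$. $\mathcal B^{(1)}_{l-1}$ is the set of $\mathbf a\in\mathcal B_{\mathbb Z}$ with $a_{i+l,j+l}=a_{i,j}$ for all $i<j$; such an $\mathbf a$ is aperiodic if for all $i<j$ at least one of $a_{i,j},a_{i+1,j+1},\dots,a_{i+l-1,j+l-1}$ is $0$, and $\mathcal B^{(1),ap}_{l-1}$ is the set of aperiodic elements. $\mathcal B^{(1)}_{l-1}(\mathbf 0)$ is the set of $\mathbf a\in\mathcal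 B^{(1)}_{l-1}$ with $\min\{a_{i,j}\mid j-i=n\}=0$ for all $n\ge1$. Put $\mathbf a^I=(a_{i,j})_{i<j;\,i,j\in\widetilde I}$. For $\mathbf k=\{k_{n+1}<\dots<k_{n+u}\}\in\mathcal M_I^\times$ set $$M_{\mathbf k}(\mathbf a^I)=-\sum_{j=n+1}^{n+u}\sum_{i=n+1}^{k_j-1}a_{i,k_j}+\min_C\sum_{n+1\le p<q\le n+u}a_{c_{p,q},\,c_{p,q}+(q-p)},$$ where $C=(c_{p,q})_{n+1\le p\le q\le n+u}$ runs over the upper triangular integer matrices with $c_{p,p}=k_p$, $c_{p,q}\le c_{p,q+1}$ and $c_{p,q}<c_{p+1,q}$. **Proposition.** 1. For all $\mathbf a\in\mathcal B_{\mathbb Z}$ and $\mathbf k\in\mathcal M_{\mathbb Z}$ there is a finite interval $I_0$ with $\mathbf k\in\mathcal M_{\mathbb Z}(I_0)$ and $M_{\mathrm{res}_J(\mathbf k)}(\mathbf a^J)=M_{\mathrm{res}_{I_0}(\mathbf k)}(\mathbf a^{I_0})$ for all finite intervals $J\supset I_0$, and $M_{\mathbf k}(\mathbf a):=M_{\mathrm{res}_{I_0}(\mathbf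 k)}(\mathbf a^{I_0})$ does not depend on the choice of such an $I_0$. Thus $\Phi_{\mathbb Z}(\mathbf a):=\mathbf M(\mathbf a):=(M_{\mathbf k}(\mathbf a))_{\mathbf k\in\mathcal M_{\mathbb Z}}$ is well defined. 2. $\mathcal B^{(1),ap}_{l-1}=\mathcal B^{(1)}_{l-1}(\mathbf 0)$, and for every $\mathbf a\in\mathcal B^{(1),ap}_{l-1}$ the family $\mathbf M(\mathbf a)$ is an $e$-BZ datum associated to $\mathbb Z$; that is, $\Phi_{\mathbb Z}$ restricts to a map $\mathcal B^{(1),ap}_{l-1}\to\mathcal{BZ}^e_{\mathbb Z}$. 3. This map takes values in $(\mathcal{BZ}^e_{\mathbb Z})^\sigma$. -/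

import Mathlib

namespace AffineBZ

/-! ### Finite intervals and Maya diagrams -/

/-- Finite (nonempty) intervals `I = [n+1, n+m]` in `ℤ`, with `I.fst = n+1`, `I.snd = n+m`;
`I ≤ J` means `I ⊆ J`. -/
abbrev FinInterval : Type := NonemptyInterval ℤ

/-- `Ĩ = I ∪ {n+m+1}`. -/
noncomputable def tilde (I : FinInterval) : Finset ℤ := Finset.Icc I.fst (I.snd + 1)

/-- `k ∈ 𝓜_I^×`: a Maya diagram associated to `I`, i.e. a subset of `Ĩ`, different from `∅`
and `Ĩ`. -/
def IsProperMaya (I : FinInterval) (k : Finset ℤ) : Prop :=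
  k ⊆ tilde I ∧ k ≠ ∅ ∧ k ≠ tilde I

/-- The set `𝓜_I^×`. -/
abbrev ProperMaya (I : FinInterval) : Type := {k : Finset ℤ // IsProperMaya I k}

/-- `k` is a Maya diagram of charge `r`. -/
def IsMayaOfCharge (r : ℤ) (k : Set ℤ) : Prop :=
  ∃ p q : ℕ, Set.Iic (r - p) ⊆ k ∧ k ⊆ Set.Iic (r + q) ∧
    (k ∩ Set.Ioi (r - p)).encard = p

/-- The set `𝓜_ℤ` of all Maya diagrams (of arbitrary charge). -/
abbrev MayaZ : Type := {k : Set ℤ // ∃ r : ℤ, IsMayaOfCharge r k}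

theorem exists_charge {k : Set ℤ} {a b : ℤ} (ha : Set.Iic a ⊆ k) (hb : k ⊆ Set.Iic b) :
    ∃ r : ℤ, IsMayaOfCharge r k := by
  have hfin : (k ∩ Set.Ioi a).Finite :=
    (Set.finite_Ioc a b).subset fun x hx => ⟨hx.2, hb hx.1⟩
  refine ⟨a + (k ∩ Set.Ioi a).ncard, (k ∩ Set.Ioi a).ncard,
    (b - (a + (k ∩ Set.Ioi a).ncard)).toNat, ?_, ?_, ?_⟩
  · simpa using ha
  · intro x hx
    have h1 : x ≤ b := hb hx
    have h2 := Int.self_le_toNat (b - (a + (k ∩ Set.Ioi a).ncard))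
    simp only [Set.mem_Iic]
    linarith
  · simpa using hfin.cast_ncard_eq.symm

theorem exists_bounds (k : MayaZ) : ∃ a b : ℤ, Set.Iic a ⊆ k.1 ∧ k.1 ⊆ Set.Iic b := by
  obtain ⟨r, p, q, h1, h2, -⟩ := k.2
  exact ⟨_, _, h1, h2⟩

/-- `s ↦ ℤ_{≤ n} ∪ s`, for `I = [n+1, n+m]` and a finite set `s`; on `𝓜_I^×` this is
`res_I⁻¹`. -/
def ofRes (I : FinInterval) (s : Finset ℤ) : MayaZ :=
  ⟨Set.Iic (I.fst - 1) ∪ (s : Set ℤ), by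
    obtain ⟨b, hb⟩ := s.bddAbove
    refine exists_charge (a := I.fst - 1) (b := max (I.fst - 1) b) Set.subset_union_left ?_
    rintro x (hx | hx)
    · exact Set.mem_Iic.2 (le_trans (Set.mem_Iic.1 hx) (le_max_left _ _))
    · exact Set.mem_Iic.2 (le_trans (hb hx) (le_max_right _ _))⟩

/-- The subset `𝓜_ℤ(I)` of `𝓜_ℤ`. -/
def MZ (I : FinInterval) : Set MayaZ :=
  {k | ∃ s : Finset ℤ, IsProperMaya I s ∧ k.1 = Set.Iic (I.fst - 1) ∪ (s : Set ℤ)}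

open Classical in
/-- `res_I(k) = k ∩ Ĩ`. -/
noncomputable def res (I : FinInterval) (k : MayaZ) : Finset ℤ :=
  (tilde I).filter (fun x => x ∈ k.1)

/-- `res_I` and `ofRes I` are mutually inverse bijections between `𝓜_ℤ(I)` and `𝓜_I^×`. -/
theorem res_ofRes (I : FinInterval) (s : Finset ℤ) (hs : IsProperMaya I s) :
    ofRes I s ∈ MZ I ∧ res I (ofRes I s) = s := by
  refine ⟨⟨s, hs, rfl⟩, ?_⟩
  ext x
  simp only [res, ofRes, tilde, Finset.mem_filter, Finset.mem_Icc, Set.mem_union, Set.mem_Iic,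
    Finset.mem_coe]
  constructor
  · rintro ⟨h, h' | h'⟩
    · omega
    · exact h'
  · intro hx
    exact ⟨by simpa [tilde] using hs.1 hx, Or.inr hx⟩

theorem ofRes_res (I : FinInterval) (k : MayaZ) (hk : k ∈ MZ I) :
    IsProperMaya I (res I k) ∧ ofRes I (res I k) = k := by
  obtain ⟨s, hs, h⟩ := hk
  have hk' : k = ofRes I s := Subtype.ext h
  subst hk'
  rw [(res_ofRes I s hs).2]
  exact ⟨hs, rfl⟩

/-- `Ω_I(k) = res_I⁻¹(Ĩ ∖ res_I(k))` (meant for `k ∈ 𝓜_ℤ(I)`). -/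
noncomputable def Omega (I : FinInterval) (k : MayaZ) : MayaZ :=
  ofRes I (tilde I \ res I k)

/-- The translation `τ^d` on Maya diagrams: `k ↦ {x + d | x ∈ k}`. -/
def shift (d : ℤ) (k : MayaZ) : MayaZ :=
  ⟨(fun x => x + d) '' k.1, by
    obtain ⟨a, b, ha, hb⟩ := exists_bounds k
    refine exists_charge (a := a + d) (b := b + d) ?_ ?_
    · intro x hx
      exact ⟨x - d, ha (by simp only [Set.mem_Iic] at hx ⊢; linarith), by ring⟩
    · rintro _ ⟨x, hx, rfl⟩
      have := hb hx
      simp only [Set.mem_Iic] at this ⊢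
      linarith⟩

/-! ### Berenstein-Zelevinsky data -/

open Classical in
/-- Extension of a collection indexed by `𝓜_I^×` with the convention `M_∅ = M_Ĩ = 0`. -/
noncomputable def ext0 {I : FinInterval} (M : ProperMaya I → ℤ) (s : Finset ℤ) : ℤ :=
  if h : IsProperMaya I s then M ⟨s, h⟩ else 0

/-- A BZ datum associated to the finite interval `I`. -/
structure IsBZ {I : FinInterval} (M : ProperMaya I → ℤ) : Prop where
  bz1 : ∀ i ∈ tilde I, ∀ j ∈ tilde I, i ≠ j → ∀ s ⊆ tilde I, i ∉ s → j ∉ s →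
    ext0 M (s ∪ {i}) + ext0 M (s ∪ {j}) ≤ ext0 M (s ∪ {i, j}) + ext0 M s
  bz2 : ∀ i ∈ tilde I, ∀ j ∈ tilde I, ∀ k ∈ tilde I, i < j → j < k →
    ∀ s ⊆ tilde I, i ∉ s → j ∉ s → k ∉ s →
    ext0 M (s ∪ {i, k}) + ext0 M (s ∪ {j}) =
      min (ext0 M (s ∪ {i, j}) + ext0 M (s ∪ {k}))
        (ext0 M (s ∪ {j, k}) + ext0 M (s ∪ {i}))

/-- An `e`-BZ datum associated to the finite interval `I`: the components at
`k(Λ_i^I) = [n+1, i]`, `i ∈ I`, vanish. -/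
structure IsFinEBZ {I : FinInterval} (M : ProperMaya I → ℤ) : Prop extends IsBZ M where
  bz0 : ∀ i : ℤ, I.fst ≤ i → i ≤ I.snd → ext0 M (Finset.Icc I.fst i) = 0

/-- `M_K`, regarded as a collection indexed by `𝓜_K^×`. -/
def restrictTo (M : MayaZ → ℤ) (K : FinInterval) : ProperMaya K → ℤ :=
  fun s => M (ofRes K s.1)

/-- The set `BZ_ℤ^e` of `e`-BZ data associated to `ℤ`. -/
def BZe : Set (MayaZ → ℤ) :=
  {M | (∀ K : FinInterval, IsFinEBZ (restrictTo M K)) ∧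
    ∀ k : MayaZ, ∃ I : FinInterval, k ∈ MZ I ∧
      ∀ J : FinInterval, I ≤ J → M (Omega J k) = M (Omega I k)}

/-- `σ(M)_k = M_{σ⁻¹(k)}`, where `σ = τ^l`. -/
def sigma (l : ℕ) (M : MayaZ → ℤ) : MayaZ → ℤ := fun k => M (shift (-(l : ℤ)) k)

/-- The `σ`-fixed part `(BZ_ℤ^e)^σ`. -/
def BZeSigma (l : ℕ) : Set (MayaZ → ℤ) := {M | M ∈ BZe ∧ sigma l M = M}

/-! ### Lusztig data -/

/-- The index set `Δ_ℤ^+`. -/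
abbrev DeltaZ : Type := {p : ℤ × ℤ // p.1 < p.2}

/-- The index set `Δ_I^+`. -/
abbrev DeltaFin (I : FinInterval) : Type :=
  {p : ℤ × ℤ // p.1 ∈ tilde I ∧ p.2 ∈ tilde I ∧ p.1 < p.2}

/-- The set `B_I` of Lusztig data associated to `I`. -/
abbrev LusztigFin (I : FinInterval) : Type := DeltaFin I → ℕ

/-- The set `B_ℤ` of Lusztig data associated to `ℤ`. -/
abbrev LusztigZ : Type :=
  {a : DeltaZ → ℕ // ∃ N : ℕ, 0 < N ∧ ∀ p : DeltaZ, (N : ℤ) ≤ p.1.2 - p.1.1 → a p = 0}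

/-- The restriction `a^I` of `a` to `Δ_I^+`. -/
def restrictLusztig (a : LusztigZ) (I : FinInterval) : LusztigFin I :=
  fun p => a.1 ⟨p.1, p.2.2.2⟩

/-- The entry `a_{i,j}` for `(i,j) ∈ Δ_I^+` (only such entries occur below). -/
noncomputable def entry {I : FinInterval} (a : LusztigFin I) (i j : ℤ) : ℕ :=
  if h : i ∈ tilde I ∧ j ∈ tilde I ∧ i < j then a ⟨(i, j), h⟩ else 0

/-- The `p`-th element (in increasing order, counted from `0`) of the finite set `k`. -/
def nthElt (k : Finset ℤ) (p : Fin k.card) : ℤ := k.orderEmbOfFin rfl p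

/-- `C` is a `k`-tableau. Rows and columns are indexed from `0` to `|k| - 1`; only the upper
triangular part `p ≤ q` of `C` is relevant. -/
structure IsTableau (k : Finset ℤ) (C : Fin k.card → Fin k.card → ℤ) : Prop where
  diag : ∀ p, C p p = nthElt k p
  row : ∀ p q q', p ≤ q → q ≤ q' → C p q ≤ C p q'
  col : ∀ p p' q, p < p' → p' ≤ q → C p q < C p' q

/-- `∑_{p<q} a_{c_{p,q}, c_{p,q}+(q-p)}`. -/
noncomputable def tableauWeight {I : FinInterval} (a : LusztigFin I) (k : Finset ℤ)
    (C : Fin k.card → Fin k.card → ℤ) : ℕ :=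
  ∑ p : Fin k.card, ∑ q ∈ Finset.Ioi p,
    entry a (C p q) (C p q + (((q : ℕ) : ℤ) - ((p : ℕ) : ℤ)))

/-- The minimum of the weights of all `k`-tableaux. -/
noncomputable def minWeight {I : FinInterval} (a : LusztigFin I) (k : Finset ℤ) : ℕ :=
  sInf {w | ∃ C, IsTableau k C ∧ w = tableauWeight a k C}

/-- The minimum is over a nonempty set, hence attained. -/
theorem isLeast_minWeight {I : FinInterval} (a : LusztigFin I) (k : Finset ℤ) :
    IsLeast {w | ∃ C, IsTableau k C ∧ w = tableauWeight a k C} (minWeight a k) := by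
  have hne : {w | ∃ C, IsTableau k C ∧ w = tableauWeight a k C}.Nonempty :=
    ⟨_, fun p _ => nthElt k p, ⟨fun _ => rfl, fun _ _ _ _ _ => le_rfl,
      fun p p' _ h _ => (k.orderEmbOfFin rfl).strictMono h⟩, rfl⟩
  exact ⟨Nat.sInf_mem hne, fun w hw => Nat.sInf_le hw⟩

/-- The integer `M_k(a)` for a Lusztig datum `a` associated to `I = [n+1, n+m]` and
`k ∈ 𝓜_I^×`. -/
noncomputable def MFin {I : FinInterval} (a : LusztigFin I) (k : Finset ℤ) : ℤ :=
  -(∑ j ∈ k, ∑ i ∈ Finset.Ico I.fst j, (entry a i j : ℤ)) + (minWeight a k : ℤ)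

/-- The value `M_{res_I(k)}(a^I)`. -/
noncomputable def MAt (a : LusztigZ) (k : MayaZ) (I : FinInterval) : ℤ :=
  MFin (restrictLusztig a I) (res I k)

/-- `k ∈ 𝓜_ℤ(I)`, and `M_{res_J(k)}(a^J)` is constant for the finite intervals `J ⊇ I`. -/
def IsStabilizing (a : LusztigZ) (k : MayaZ) (I : FinInterval) : Prop :=
  k ∈ MZ I ∧ ∀ J : FinInterval, I ≤ J → MAt a k J = MAt a k I

open Classical in
/-- The map `Φ_ℤ : a ↦ M(a)`: the component `M_k(a)` is the stable value of
`M_{res_I(k)}(a^I)` (and `0` if there were no stabilizing interval). -/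
noncomputable def PhiZ (a : LusztigZ) (k : MayaZ) : ℤ :=
  if h : ∃ I, IsStabilizing a k I then MAt a k h.choose else 0

/-- The set `B_{l-1}^{(1)}` of Lusztig data of type `A_{l-1}^{(1)}`. -/
def BAff (l : ℕ) : Set LusztigZ :=
  {a | ∀ (i j : ℤ) (h : i < j), a.1 ⟨(i, j), h⟩ = a.1 ⟨(i + l, j + l), by simpa using h⟩}

/-- The set `B_{l-1}^{(1),ap}` of aperiodic Lusztig data. -/
def BAp (l : ℕ) : Set LusztigZ :=
  {a | a ∈ BAff l ∧ ∀ (i j : ℤ) (h : i < j),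
    ∃ s : ℕ, s < l ∧ a.1 ⟨(i + s, j + s), by simpa using h⟩ = 0}

/-- `z(a)_n = min {a_{i,j} | j - i = n}` for `n ≥ 1`. -/
noncomputable def zSeq (a : LusztigZ) (n : ℕ+) : ℕ :=
  sInf {x | ∃ p : DeltaZ, p.1.2 - p.1.1 = (n : ℤ) ∧ x = a.1 p}

/-- The set `B_{l-1}^{(1)}(z)`. -/
def BOfZ (l : ℕ) (z : ℕ+ → ℕ) : Set LusztigZ := {a | a ∈ BAff l ∧ zSeq a = z}

end AffineBZ

/-! The minimum over tableaux is the tropical shadow of a determinant. Deleting the diagonal of a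
tableau leaves a smaller tableau whose diagonal interlaces the old one. Hence the polynomial
counting tableaux by `X ^ weight` satisfies a Gelfand–Tsetlin recursion, which telescoping row
operations identify with an alternant `det (g_i(x_p))`. Its coefficients are positive, so orders at
`X = 0` add under products and take minima under sums. The three-term Plücker relation for
alternants therefore becomes axiom (2) for minimal weights (`setWt_plucker`). Sorting signs are
absorbed by multiplying with Vandermonde determinants. Axiom (1) follows formally from (2) and the
case where the set fills the gap between the two indices (`edge_of_plucker`); there all four sets
are intervals, whose tableaux are unique. The linear part of `M` affects neither axiom, being
additive in the set.

Stability comes from finite width: `a i j = 0` once `j - i ≥ N`. If a set starts with a run of `N`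
consecutive integers, prepending another integer adds the same amount to the minimal weight and to
the linear part, so `M` is unchanged (`mVal_extend`). A Maya diagram may thus be replaced by a
finite set beginning with such a run. The same holds for appending an integer after a terminal run.

For complements, `ℤ_{≤ n}` recedes from the holes of `k` as the interval grows to the left.
Aperiodicity gives a zero of every diagonal of `a` in each window of length `l`, so across a wide
gap the tableaux of both pieces can be joined by a rectangle of weight zero and their weights add
(`setWt_union_of_gap`). The resulting value no longer depends on the gap. Aperiodicity is needed
only here; `σ`-invariance is translation invariance of the construction. -/

namespace AffineBZ

open Polynomial

/-! ### Orders of polynomials with positive lowest coefficient -/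

/-- `P` has order `n` at `0`, with a positive lowest coefficient. -/
def HasOrder (P : ℤ[X]) (n : ℕ) : Prop := ∃ Q : ℤ[X], P = X ^ n * Q ∧ 0 < Q.eval 0

theorem hasOrder_one : HasOrder 1 0 := ⟨1, by simp, by simp⟩

theorem hasOrder_X_pow (n : ℕ) : HasOrder (X ^ n) n := ⟨1, by simp, by simp⟩

theorem HasOrder.mul {P Q : ℤ[X]} {m n : ℕ} (hP : HasOrder P m) (hQ : HasOrder Q n) :
    HasOrder (P * Q) (m + n) := by
  obtain ⟨P', rfl, hP'⟩ := hP
  obtain ⟨Q', rfl, hQ'⟩ := hQ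
  exact ⟨P' * Q', by ring, by rw [eval_mul]; positivity⟩

theorem HasOrder.C_mul {P : ℤ[X]} {n : ℕ} {c : ℤ} (hc : 0 < c) (hP : HasOrder P n) :
    HasOrder (C c * P) n := by
  obtain ⟨Q, rfl, hQ⟩ := hP
  exact ⟨C c * Q, by ring, by rw [eval_mul, eval_C]; positivity⟩

theorem HasOrder.unique {P : ℤ[X]} {m n : ℕ} (hm : HasOrder P m) (hn : HasOrder P n) :
    m = n := by
  obtain ⟨Q, rfl, hQ⟩ := hm
  obtain ⟨Q', h, hQ'⟩ := hn
  by_contra hne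
  wlog hlt : m < n generalizing m n Q Q'
  · exact this Q' hQ' Q h.symm hQ (Ne.symm hne) (by omega)
  obtain ⟨d, rfl⟩ := Nat.exists_eq_add_of_lt hlt
  have h2 : X ^ m * Q = X ^ m * (X ^ (d + 1) * Q') := by rw [h]; ring
  have h3 := mul_left_cancel₀ (pow_ne_zero m (X_ne_zero : (X : ℤ[X]) ≠ 0)) h2
  rw [h3] at hQ
  simp at hQ

/-- Positive lowest coefficients cannot cancel, so passing to orders turns sums into minima. -/
theorem HasOrder.sum {ι : Type*} {s : Finset ι} {g : ι → ℤ[X]} {n : ι → ℕ}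
    (hg : ∀ i ∈ s, HasOrder (g i) (n i)) {i₀ : ι} (hi₀ : i₀ ∈ s)
    (hmin : ∀ i ∈ s, n i₀ ≤ n i) : HasOrder (∑ i ∈ s, g i) (n i₀) := by
  choose! Q hQ hQ' using hg
  refine ⟨∑ i ∈ s, X ^ (n i - n i₀) * Q i, ?_, ?_⟩
  · rw [Finset.mul_sum]
    refine Finset.sum_congr rfl fun i hi => ?_
    rw [hQ i hi, ← mul_assoc, ← pow_add, Nat.add_sub_cancel' (hmin i hi)]
  · rw [eval_finsetSum]
    refine Finset.sum_pos' (fun i hi => ?_) ⟨i₀, hi₀, ?_⟩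
    · rw [eval_mul, eval_pow, eval_X]
      exact mul_nonneg (pow_nonneg le_rfl _) (hQ' i hi).le
    · simpa using hQ' i₀ hi₀

theorem HasOrder.add {P Q : ℤ[X]} {m n : ℕ} (hP : HasOrder P m) (hQ : HasOrder Q n) :
    HasOrder (P + Q) (min m n) := by
  wlog hmn : m ≤ n generalizing P Q m n
  · rw [add_comm, min_comm]
    exact this hQ hP (by omega)
  rw [min_eq_left hmn]
  obtain ⟨P', rfl, hP'⟩ := hP
  obtain ⟨Q', rfl, hQ'⟩ := hQ
  obtain ⟨d, rfl⟩ := Nat.exists_eq_add_of_le hmn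
  refine ⟨P' + X ^ d * Q', by ring, ?_⟩
  rw [eval_add, eval_mul, eval_pow, eval_X]
  have : (0 : ℤ) ≤ 0 ^ d * Q'.eval 0 := mul_nonneg (pow_nonneg le_rfl _) hQ'.le
  linarith

/-! ### Tableaux on a strictly increasing sequence -/

/-- The upper triangular part of size `u` of `C` is a tableau with diagonal `x`. -/
structure IsTab (u : ℕ) (x : ℕ → ℤ) (C : ℕ → ℕ → ℤ) : Prop where
  diag : ∀ p < u, C p p = x p
  row : ∀ p q, p ≤ q → q + 1 < u → C p q ≤ C p (q + 1)
  col : ∀ p q, p < q → q < u → C p q < C (p + 1) q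

/-- The weight of a tableau, the entry `c` on the `d`-th diagonal having weight `w d c`. -/
def tabWt (w : ℕ → ℤ → ℕ) (u : ℕ) (C : ℕ → ℕ → ℤ) : ℕ :=
  ∑ q ∈ Finset.range u, ∑ p ∈ Finset.range q, w (q - p) (C p q)

/-- `n` is the smallest weight of a tableau with diagonal `x`. -/
def IsMinWt (w : ℕ → ℤ → ℕ) (u : ℕ) (x : ℕ → ℤ) (n : ℕ) : Prop :=
  IsLeast {n | ∃ C, IsTab u x C ∧ n = tabWt w u C} n

/-- The first superdiagonal interlaces the diagonal and is itself the diagonal of a smaller tableau.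
With its inverse `IsTab.unpeel`, this drives the induction on the size. -/
theorem IsTab.peel {u : ℕ} {x : ℕ → ℤ} {C : ℕ → ℕ → ℤ} (h : IsTab (u + 1) x C) :
    (∀ p < u, x p ≤ C p (p + 1) ∧ C p (p + 1) < x (p + 1)) ∧
      IsTab u (fun p => C p (p + 1)) (fun p q => C p (q + 1)) := by
  refine ⟨fun p hp => ⟨?_, ?_⟩, fun p _ => rfl, fun p q hpq hq => ?_, fun p q hpq hq => ?_⟩
  · rw [← h.diag p (by omega)]
    exact h.row p p le_rfl (by omega)
  · rw [← h.diag (p + 1) (by omega)]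
    exact h.col p (p + 1) (by omega) (by omega)
  · exact h.row p (q + 1) (by omega) (by omega)
  · exact h.col p (q + 1) (by omega) (by omega)

theorem tabWt_peel (w : ℕ → ℤ → ℕ) (u : ℕ) (C : ℕ → ℕ → ℤ) :
    tabWt w (u + 1) C = ∑ p ∈ Finset.range u, w 1 (C p (p + 1)) +
      tabWt (fun d => w (d + 1)) u (fun p q => C p (q + 1)) := by
  unfold tabWt
  rw [Finset.sum_range_succ', Finset.sum_range_zero, add_zero, ← Finset.sum_add_distrib]
  refine Finset.sum_congr rfl fun q _ => ?_
  rw [Finset.sum_range_succ, add_comm]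
  congr 1
  · simp
  · refine Finset.sum_congr rfl fun p hp => ?_
    rw [Finset.mem_range] at hp
    rw [show q + 1 - p = q - p + 1 by omega]

theorem IsTab.unpeel {u : ℕ} {x y : ℕ → ℤ} {C : ℕ → ℕ → ℤ} (h : IsTab u y C)
    (hy : ∀ p < u, x p ≤ y p ∧ y p < x (p + 1)) :
    IsTab (u + 1) x (fun p q => if q ≤ p then x p else C p (q - 1)) := by
  refine ⟨fun p _ => by simp, fun p q hpq hq => ?_, fun p q hpq hq => ?_⟩
  · rcases hpq.eq_or_lt with rfl | hlt
    · simpa [h.diag p (by omega)] using (hy p (by omega)).1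
    · have := h.row p (q - 1) (by omega) (by omega)
      rw [Nat.sub_add_cancel (by omega)] at this
      simpa [show ¬ q ≤ p by omega, show ¬ q + 1 ≤ p by omega] using this
  · rcases (Nat.succ_le_of_lt hpq).eq_or_lt with rfl | hlt
    · simpa [h.diag p (by omega)] using (hy p (by omega)).2
    · have := h.col p (q - 1) (by omega) (by omega)
      simpa [show ¬ q ≤ p by omega, show ¬ q ≤ p + 1 by omega] using this

theorem tabWt_unpeel (w : ℕ → ℤ → ℕ) {u : ℕ} {x y : ℕ → ℤ} {C : ℕ → ℕ → ℤ}
    (h : IsTab u y C) :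
    tabWt w (u + 1) (fun p q => if q ≤ p then x p else C p (q - 1)) =
      ∑ p ∈ Finset.range u, w 1 (y p) + tabWt (fun d => w (d + 1)) u C := by
  rw [tabWt_peel]
  congr 1
  · refine Finset.sum_congr rfl fun p hp => ?_
    simp [h.diag p (by simpa using hp)]
  · refine Finset.sum_congr rfl fun q _ => Finset.sum_congr rfl fun p hp => ?_
    have : ¬ q + 1 ≤ p := by rw [Finset.mem_range] at hp; omega
    simp [this]

theorem IsTab.congr {u : ℕ} {x y : ℕ → ℤ} {C : ℕ → ℕ → ℤ} (h : IsTab u x C)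
    (hxy : ∀ p < u, x p = y p) : IsTab u y C :=
  ⟨fun p hp => (h.diag p hp).trans (hxy p hp), h.row, h.col⟩

/-! ### The generating function of tableaux as a determinant -/

/-- The functions whose alternants are the generating functions of tableaux. -/
noncomputable def gtFun (b : ℤ) : (ℕ → ℤ → ℕ) → ℕ → ℤ → ℤ[X]
  | _, 0, _ => 1
  | w, i + 1, x => ∑ y ∈ Finset.Ico b x, X ^ w 1 y * gtFun b (fun d => w (d + 1)) i y

/-- The alternant of the functions `gtFun`. -/
noncomputable def gtDet (b : ℤ) (w : ℕ → ℤ → ℕ) {u : ℕ} (x : Fin u → ℤ) : ℤ[X] :=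
  (Matrix.of fun p i : Fin u => gtFun b w i (x p)).det

/-- The functions `gtFun` are iterated partial sums from `b`. Differences of consecutive rows
replace the ranges `[b, x_p)` by `[x_p, x_{p+1})` and clear the constant first column below its top
entry. Multilinearity in the rows then produces the sum over interlacing sequences. -/
theorem gtDet_succ (b : ℤ) (w : ℕ → ℤ → ℕ) {u : ℕ} (x : Fin (u + 1) → ℤ)
    (hx : ∀ p : Fin u, x p.castSucc < x p.succ) (hb : ∀ p, b ≤ x p) :
    gtDet b w x =
      ∑ y ∈ Fintype.piFinset (fun p : Fin u => Finset.Ico (x p.castSucc) (x p.succ)),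
        X ^ (∑ p, w 1 (y p)) * gtDet b (fun d => w (d + 1)) y := by
  have h1 : gtDet b w x = (Matrix.of fun p i : Fin (u + 1) =>
      Fin.cases (gtFun b w i (x 0))
        (fun p' : Fin u => gtFun b w i (x p'.succ) - gtFun b w i (x p'.castSucc)) p).det := by
    refine Matrix.det_eq_of_forall_row_eq_smul_add_pred (fun _ => 1) (fun j => by simp) ?_
    intro i j
    simp
  have h2 : gtDet b w x = (Matrix.of fun p i : Fin u =>
      ∑ y ∈ Finset.Ico (x p.castSucc) (x p.succ),
        X ^ w 1 y * gtFun b (fun d => w (d + 1)) i y).det := by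
    rw [h1, Matrix.det_succ_column_zero, Fin.sum_univ_succ]
    rw [Finset.sum_eq_zero, add_zero]
    · simp only [Fin.val_zero, pow_zero, Matrix.of_apply, Fin.cases_zero, one_mul, gtFun]
      congr 1
      ext1 p i
      simp only [Matrix.submatrix_apply, Matrix.of_apply, Fin.succAbove_zero, Fin.cases_succ,
        Fin.val_succ, gtFun]
      rw [sub_eq_iff_eq_add', ← Finset.sum_union (Finset.Ico_disjoint_Ico_consecutive _ _ _),
        Finset.Ico_union_Ico_eq_Ico (hb _) (hx p).le]
    · intro i _
      simp [gtFun]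
  rw [h2]
  have h3 := (Matrix.detRowAlternating (n := Fin u) (R := ℤ[X])).toMultilinearMap.map_sum_finset
    (fun (p : Fin u) (y : ℤ) (i : Fin u) => X ^ w 1 y * gtFun b (fun d => w (d + 1)) i y)
    (fun p => Finset.Ico (x p.castSucc) (x p.succ))
  have h4 : (Matrix.of fun p i : Fin u => ∑ y ∈ Finset.Ico (x p.castSucc) (x p.succ),
        X ^ w 1 y * gtFun b (fun d => w (d + 1)) i y) = fun p : Fin u =>
      ∑ y ∈ Finset.Ico (x p.castSucc) (x p.succ), fun i : Fin u =>
        X ^ w 1 y * gtFun b (fun d => w (d + 1)) i y := by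
    ext1 p i
    simp
  rw [h4]
  refine h3.trans (Finset.sum_congr rfl fun y _ => ?_)
  have h5 := Matrix.det_mul_column (fun p : Fin u => (X : ℤ[X]) ^ w 1 (y p))
    (Matrix.of fun p i : Fin u => gtFun b (fun d => w (d + 1)) i (y p))
  rw [Finset.prod_pow_eq_pow_sum] at h5
  exact h5

/-- Both the minimal weight and the order of the determinant obey the recursion over interlacing
`y`: a minimum on one side, a sum of polynomials with positive lowest coefficients on the other. -/
theorem exists_isMinWt_hasOrder (b : ℤ) (u : ℕ) : ∀ (w : ℕ → ℤ → ℕ) (x : ℕ → ℤ),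
    (∀ p, p + 1 < u → x p < x (p + 1)) → (∀ p < u, b ≤ x p) →
    ∃ n, IsMinWt w u x n ∧ HasOrder (gtDet b w (fun p : Fin u => x p)) n := by
  induction u with
  | zero =>
    intro w x _ _
    refine ⟨0, ⟨⟨fun p _ => x p, ⟨by simp, by simp, by simp⟩, by simp [tabWt]⟩,
      fun _ _ => Nat.zero_le _⟩, ?_⟩
    simpa [gtDet] using hasOrder_one
  | succ u ih =>
    intro w x hx hb
    set s := Fintype.piFinset (fun p : Fin u => Finset.Ico (x p) (x (p + 1))) with hs
    let ext : (Fin u → ℤ) → ℕ → ℤ := fun y p => if h : p < u then y ⟨p, h⟩ else 0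
    have hext : ∀ (y : Fin u → ℤ) (p : Fin u), ext y p = y p := fun y p => by simp [ext]
    have hmem : ∀ y : Fin u → ℤ, y ∈ s ↔ ∀ p < u, x p ≤ ext y p ∧ ext y p < x (p + 1) := by
      intro y
      rw [hs, Fintype.mem_piFinset]
      constructor
      · intro h p hp
        rw [← Finset.mem_Ico, show ext y p = y ⟨p, hp⟩ from hext y ⟨p, hp⟩]
        exact h ⟨p, hp⟩
      · intro h p
        rw [Finset.mem_Ico, ← hext y p]
        exact h p p.2
    have key : ∀ y ∈ s, ∃ n, IsMinWt (fun d => w (d + 1)) u (ext y) n ∧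
        HasOrder (gtDet b (fun d => w (d + 1)) y) n := by
      intro y hy
      rw [hmem] at hy
      obtain ⟨n, hn, hn'⟩ := ih (fun d => w (d + 1)) (ext y)
        -- Interlacing makes `y` strictly increasing again: `y_p < x_{p+1} ≤ y_{p+1}`.
        (fun p hp => (hy p (by omega)).2.trans_le (hy (p + 1) hp).1)
        (fun p hp => (hb p (by omega)).trans (hy p hp).1)
      simp only [hext] at hn'
      exact ⟨n, hn, hn'⟩
    choose! n hn hn' using key
    have hne : s.Nonempty := by
      rw [hs, Fintype.piFinset_nonempty]
      intro p
      exact Finset.nonempty_Ico.2 (hx p (by omega))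
    obtain ⟨y₀, hy₀, hmin⟩ := Finset.exists_min_image s (fun y => ∑ p, w 1 (y p) + n y) hne
    have hsum : ∀ y : Fin u → ℤ, ∑ p ∈ Finset.range u, w 1 (ext y p) = ∑ p, w 1 (y p) := by
      intro y
      rw [Finset.sum_range]
      simp only [hext]
    refine ⟨∑ p, w 1 (y₀ p) + n y₀, ⟨?_, ?_⟩, ?_⟩
    · obtain ⟨C, hC, hCn⟩ := (hn y₀ hy₀).1
      refine ⟨_, hC.unpeel ((hmem y₀).1 hy₀), ?_⟩
      rw [tabWt_unpeel w hC, hsum, hCn]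
    · rintro _ ⟨C, hC, rfl⟩
      obtain ⟨h1, h2⟩ := hC.peel
      have hy : ∀ p < u, ext (fun p : Fin u => C p (p + 1)) p = C p (p + 1) := by
        intro p hp
        simp [ext, hp]
      have hys : (fun p : Fin u => C p (p + 1)) ∈ s := by
        rw [hmem]
        intro p hp
        rw [hy p hp]
        exact h1 p hp
      refine (hmin _ hys).trans ?_
      rw [tabWt_peel, ← hsum]
      refine add_le_add (Finset.sum_le_sum fun p hp => ?_) ?_
      · rw [hy p (by simpa using hp)]
      · exact (hn _ hys).2 ⟨_, h2.congr fun p hp => (hy p hp).symm, rfl⟩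
    · have := gtDet_succ b w (fun p : Fin (u + 1) => x p) (fun p => by
        simpa using hx p (by omega)) (fun p => hb p p.2)
      simp only [Fin.val_castSucc, Fin.val_succ] at this
      rw [this]
      exact HasOrder.sum (n := fun y => ∑ p, w 1 (y p) + n y)
        (fun y hy => (hasOrder_X_pow _).mul (hn' y hy)) hy₀ hmin

/-! ### The three-term Plücker relation for alternants -/

/-- The alternant `det (g_i(y_p))`. -/
def alternant {R : Type*} [CommRing R] (g : ℕ → ℤ → R) {u : ℕ} (y : Fin u → ℤ) : R :=
  (Matrix.of fun p i : Fin u => g i (y p)).det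

/-- Cramer's rule expands `det A` times the row at `j` in the rows of `A`, which belong to `i`, `k`
and `S`. Applying the smaller alternant, which is linear in its first row, kills the rows of `S`,
since they then occur twice. The rows of `i` and `k` give the two terms. -/
theorem alternant_plucker {R : Type*} [CommRing R] (g : ℕ → ℤ → R) {m : ℕ} (S : Fin m → ℤ)
    (i j k : ℤ) :
    alternant g (Fin.cons i (Fin.cons k S : Fin (m + 1) → ℤ) : Fin (m + 2) → ℤ) *
        alternant g (Fin.cons j S : Fin (m + 1) → ℤ) =
      alternant g (Fin.cons i (Fin.cons j S : Fin (m + 1) → ℤ) : Fin (m + 2) → ℤ) *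
          alternant g (Fin.cons k S : Fin (m + 1) → ℤ) +
        alternant g (Fin.cons j (Fin.cons k S : Fin (m + 1) → ℤ) : Fin (m + 2) → ℤ) *
          alternant g (Fin.cons i S : Fin (m + 1) → ℤ) := by
  set y : Fin (m + 2) → ℤ := Fin.cons i (Fin.cons k S : Fin (m + 1) → ℤ) with hy
  set A : Matrix (Fin (m + 2)) (Fin (m + 2)) R := Matrix.of fun p c => g c (y p) with hA
  -- The row at the dummy point `0` is irrelevant: component `0` of `cramer` replaces it.
  set B : Matrix (Fin (m + 1)) (Fin (m + 1)) R :=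
    Matrix.of fun p c => g c ((Fin.cons 0 S : Fin (m + 1) → ℤ) p) with hB
  set v : Fin (m + 2) → R := fun c => g c j with hv
  have hL : ∀ x : ℤ, B.transpose.cramer (fun c : Fin (m + 1) => g c x) 0 =
      alternant g (Fin.cons x S : Fin (m + 1) → ℤ) := by
    intro x
    rw [Matrix.cramer_transpose_apply, alternant]
    congr 1
    ext p c
    refine Fin.cases ?_ (fun p => ?_) p
    · simp
    · simp [hB, Matrix.updateRow_apply]
  have hrow : ∀ c : Fin (m + 1), ∑ r, A.transpose.cramer v r * g c (y r) = A.det * g c j := by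
    intro c
    have := congrFun (Matrix.mulVec_cramer A.transpose v) c.castSucc
    rw [Matrix.det_transpose] at this
    simp only [Matrix.mulVec, dotProduct, Matrix.transpose_apply, Pi.smul_apply,
      smul_eq_mul] at this
    simp only [hA, hv, Matrix.of_apply, Fin.val_castSucc] at this ⊢
    rw [← this]
    exact Finset.sum_congr rfl fun r _ => mul_comm _ _
  have h1 : ∑ r, A.transpose.cramer v r * alternant g (Fin.cons (y r) S : Fin (m + 1) → ℤ) =
      A.det * alternant g (Fin.cons j S : Fin (m + 1) → ℤ) := by
    have h2 : A.det • (fun c : Fin (m + 1) => g c j) =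
        ∑ r, A.transpose.cramer v r • (fun c : Fin (m + 1) => g c (y r)) := by
      ext c
      simpa using (hrow c).symm
    have h3 := congrFun (congrArg B.transpose.cramer h2) 0
    simp only [map_smul, map_sum, Pi.smul_apply, Finset.sum_apply, smul_eq_mul, hL] at h3
    exact h3.symm
  have hS : ∀ r : Fin m, alternant g (Fin.cons (y r.succ.succ) S : Fin (m + 1) → ℤ) = 0 := by
    intro r
    refine Matrix.det_zero_of_row_eq (i := 0) (j := r.succ) (Fin.succ_ne_zero r).symm ?_
    ext c
    simp [hy]
  rw [Fin.sum_univ_succ, Fin.sum_univ_succ, Finset.sum_eq_zero, add_zero] at h1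
  · have e0 : A.transpose.cramer v 0 =
        alternant g (Fin.cons j (Fin.cons k S : Fin (m + 1) → ℤ) : Fin (m + 2) → ℤ) := by
      rw [Matrix.cramer_transpose_apply, alternant]
      congr 1
      ext p c
      refine Fin.cases ?_ (fun p => ?_) p
      · simp [hv]
      · simp [hA, hy, Matrix.updateRow_apply]
    have e1 : A.transpose.cramer v (Fin.succ 0) =
        alternant g (Fin.cons i (Fin.cons j S : Fin (m + 1) → ℤ) : Fin (m + 2) → ℤ) := by
      rw [Matrix.cramer_transpose_apply, alternant]
      congr 1
      ext p c
      refine Fin.cases ?_ (fun p => Fin.cases ?_ (fun p => ?_) p) p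
      · simp [hA, hy, Matrix.updateRow_apply]
      · simp [hv]
      · simp [hA, hy, Matrix.updateRow_apply, Fin.ext_iff]
    rw [e0, e1] at h1
    have e2 : y (Fin.succ 0) = k := by simp [hy]
    have e3 : y 0 = i := by simp [hy]
    rw [e2, e3] at h1
    rw [show alternant g y = A.det from rfl, ← h1, add_comm]
  · intro r _
    rw [hS, mul_zero]

/-! ### The minimal weight of the tableaux of a finite set -/

/-- The elements of `s` in increasing order. -/
noncomputable def elt (s : Finset ℤ) (p : ℕ) : ℤ :=
  if h : p < s.card then nthElt s ⟨p, h⟩ else 0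

theorem elt_val (s : Finset ℤ) (p : Fin s.card) : elt s p = nthElt s p := by
  simp [elt]

theorem elt_mem {s : Finset ℤ} {p : ℕ} (hp : p < s.card) : elt s p ∈ s := by
  rw [elt, dif_pos hp]
  exact Finset.orderEmbOfFin_mem s rfl _

theorem elt_lt {s : Finset ℤ} {p q : ℕ} (hpq : p < q) (hq : q < s.card) :
    elt s p < elt s q := by
  rw [elt, elt, dif_pos (hpq.trans hq), dif_pos hq]
  exact (s.orderEmbOfFin rfl).strictMono hpq

theorem elt_unique {s : Finset ℤ} {x : ℕ → ℤ} (hmem : ∀ p < s.card, x p ∈ s)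
    (hx : ∀ p q, p < q → q < s.card → x p < x q) : ∀ p < s.card, x p = elt s p := by
  intro p hp
  have := Finset.orderEmbOfFin_unique (s := s) rfl (f := fun p : Fin s.card => x p)
    (fun p => hmem p p.2) (fun p q hpq => hx p q hpq q.2)
  rw [elt, dif_pos hp]
  exact congrFun this ⟨p, hp⟩

theorem image_elt (s : Finset ℤ) : (Finset.range s.card).image (elt s) = s := by
  refine Finset.eq_of_subset_of_card_le ?_ ?_
  · intro x hx
    obtain ⟨p, hp, rfl⟩ := Finset.mem_image.1 hx
    exact elt_mem (Finset.mem_range.1 hp)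
  · rw [Finset.card_image_of_injOn, Finset.card_range]
    intro p hp q hq hpq
    simp only [Finset.coe_range, Set.mem_Iio] at hp hq
    rcases lt_trichotomy p q with h | h | h
    · exact absurd hpq (elt_lt h hq).ne
    · exact h
    · exact absurd hpq (elt_lt h hp).ne'

/-- The minimal weight of the tableaux of `s`. -/
noncomputable def setWt (w : ℕ → ℤ → ℕ) (s : Finset ℤ) : ℕ :=
  sInf {n | ∃ C, IsTab s.card (elt s) C ∧ n = tabWt w s.card C}

theorem isMinWt_sInf (w : ℕ → ℤ → ℕ) (u : ℕ) (x : ℕ → ℤ)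
    (hx : ∀ p, p + 1 < u → x p < x (p + 1)) :
    IsMinWt w u x (sInf {n | ∃ C, IsTab u x C ∧ n = tabWt w u C}) := by
  have hne : {n | ∃ C, IsTab u x C ∧ n = tabWt w u C}.Nonempty :=
    ⟨_, fun p _ => x p, ⟨fun _ _ => rfl, fun _ _ _ _ => le_rfl,
      fun p q h hq => hx p (by omega)⟩, rfl⟩
  exact ⟨Nat.sInf_mem hne, fun n hn => Nat.sInf_le hn⟩

theorem isMinWt_setWt (w : ℕ → ℤ → ℕ) (s : Finset ℤ) :
    IsMinWt w s.card (elt s) (setWt w s) :=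
  isMinWt_sInf w _ _ fun _ hp => elt_lt (Nat.lt_succ_self _) hp

theorem IsMinWt.congr {w : ℕ → ℤ → ℕ} {u : ℕ} {x y : ℕ → ℤ} {n : ℕ} (h : IsMinWt w u x n)
    (hxy : ∀ p < u, x p = y p) : IsMinWt w u y n := by
  obtain ⟨⟨C, hC, hn⟩, h2⟩ := h
  refine ⟨⟨C, hC.congr hxy, hn⟩, ?_⟩
  rintro _ ⟨C', hC', rfl⟩
  exact h2 ⟨C', hC'.congr fun p hp => (hxy p hp).symm, rfl⟩

theorem IsMinWt.eq_setWt {w : ℕ → ℤ → ℕ} {s : Finset ℤ} {u : ℕ} {x : ℕ → ℤ} {n : ℕ}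
    (h : IsMinWt w u x n) (hu : s.card = u) (hmem : ∀ p < u, x p ∈ s)
    (hx : ∀ p q, p < q → q < u → x p < x q) : n = setWt w s := by
  subst hu
  exact (h.congr (elt_unique hmem hx)).unique (isMinWt_setWt w s)

/-- Reordering the points changes the alternant and the Vandermonde determinant by the same sign, so
their product may be computed for sorted points, where the latter is positive. -/
theorem hasOrder_alternant (b : ℤ) (w : ℕ → ℤ → ℕ) {u : ℕ} (y : Fin u → ℤ)
    (hy : Function.Injective y) (hb : ∀ p, b ≤ y p) :
    HasOrder (C (Matrix.vandermonde y).det * alternant (gtFun b w) y)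
      (setWt w (Finset.univ.image y)) := by
  set σ := Tuple.sort y with hσ
  set z : Fin u → ℤ := y ∘ σ with hz
  have hzm : StrictMono z :=
    (Tuple.monotone_sort y).strictMono_of_injective (hy.comp σ.injective)
  have h1 : (Matrix.vandermonde z).det = (Equiv.Perm.sign σ : ℤ) * (Matrix.vandermonde y).det := by
    rw [← Int.cast_id (n := ((Equiv.Perm.sign σ : ℤˣ) : ℤ)), ← Matrix.det_permute]
    rfl
  have h2 : alternant (gtFun b w) z =
      ((Equiv.Perm.sign σ : ℤ) : ℤ[X]) * alternant (gtFun b w) y := by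
    rw [alternant, alternant, ← Matrix.det_permute]
    rfl
  have h3 : C (Matrix.vandermonde y).det * alternant (gtFun b w) y =
      C (Matrix.vandermonde z).det * alternant (gtFun b w) z := by
    rw [h1, h2]
    rcases Int.units_eq_one_or (Equiv.Perm.sign σ) with h | h <;> simp [h]
  rw [h3]
  refine HasOrder.C_mul ?_ ?_
  · rw [Matrix.det_vandermonde]
    refine Finset.prod_pos fun i _ => Finset.prod_pos fun j hj => ?_
    exact sub_pos.2 (hzm (Finset.mem_Ioi.1 hj))
  · let x : ℕ → ℤ := fun p => if h : p < u then z ⟨p, h⟩ else 0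
    have hxz : ∀ p : Fin u, x p = z p := fun p => by simp [x]
    have hx : ∀ p q, p < q → q < u → x p < x q := by
      intro p q hpq hq
      rw [show x p = z ⟨p, hpq.trans hq⟩ from hxz ⟨p, hpq.trans hq⟩,
        show x q = z ⟨q, hq⟩ from hxz ⟨q, hq⟩]
      exact hzm hpq
    have hxb : ∀ p < u, b ≤ x p := by
      intro p hp
      rw [show x p = z ⟨p, hp⟩ from hxz ⟨p, hp⟩]
      exact hb _
    obtain ⟨n, hn, hn'⟩ := exists_isMinWt_hasOrder b u w x
      (fun p hp => hx p (p + 1) (by omega) hp) hxb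
    rw [hn.eq_setWt (s := Finset.univ.image y)
      (by rw [Finset.card_image_of_injective _ hy, Finset.card_univ, Fintype.card_fin])
      (fun p hp => by
        rw [show x p = z ⟨p, hp⟩ from hxz ⟨p, hp⟩]
        exact Finset.mem_image_of_mem _ (Finset.mem_univ _)) hx] at hn'
    simp only [hxz] at hn'
    exact hn'

theorem det_vandermonde_cons {u : ℕ} (a : ℤ) (v : Fin u → ℤ) :
    (Matrix.vandermonde (Fin.cons a v : Fin (u + 1) → ℤ)).det =
      (∏ p, (v p - a)) * (Matrix.vandermonde v).det := by
  rw [Matrix.det_vandermonde, Matrix.det_vandermonde, Fin.prod_univ_succ, Fin.prod_Ioi_zero]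
  congr 1
  refine Finset.prod_congr rfl fun i _ => ?_
  rw [Fin.prod_Ioi_succ]
  rfl

theorem image_cons {u : ℕ} (a : ℤ) (v : Fin u → ℤ) :
    Finset.univ.image (Fin.cons a v : Fin (u + 1) → ℤ) = insert a (Finset.univ.image v) := by
  ext x
  simp [Fin.exists_fin_succ, eq_comm]

theorem HasOrder.of_C_mul {P : ℤ[X]} {n : ℕ} {c : ℤ} (hc : 0 < c)
    {Q R : ℤ[X]} {k m : ℕ} (hP : HasOrder (C c * P) n) {d e : ℤ} (hd : 0 < d) (he : 0 < e)
    (hQ : HasOrder (C d * Q) k) (hR : HasOrder (C e * R) m) (h : P = Q + R) :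
    n = min k m := by
  have h1 : HasOrder (C (c * d * e) * P) n := by
    rw [show C (c * d * e) * P = C (d * e) * (C c * P) by simp only [map_mul]; ring]
    exact hP.C_mul (mul_pos hd he)
  have h2 : HasOrder (C (c * d * e) * Q) k := by
    rw [show C (c * d * e) * Q = C (c * e) * (C d * Q) by simp only [map_mul]; ring]
    exact hQ.C_mul (mul_pos hc he)
  have h3 : HasOrder (C (c * d * e) * R) m := by
    rw [show C (c * d * e) * R = C (c * d) * (C e * R) by simp only [map_mul]; ring]
    exact hR.C_mul (mul_pos hc hd)
  rw [h, mul_add] at h1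
  exact h1.unique (h2.add h3)

/-- This is the tropicalization of `alternant_plucker`. -/
theorem setWt_plucker (w : ℕ → ℤ → ℕ) (S : Finset ℤ) {i j k : ℤ} (hij : i < j) (hjk : j < k)
    (hi : i ∉ S) (hj : j ∉ S) (hk : k ∉ S) :
    setWt w (insert i (insert k S)) + setWt w (insert j S) =
      min (setWt w (insert i (insert j S)) + setWt w (insert k S))
        (setWt w (insert j (insert k S)) + setWt w (insert i S)) := by
  obtain ⟨b, hb⟩ := (insert i (insert j (insert k S))).bddBelow
  have hbi : b ≤ i := hb (by simp)
  have hbj : b ≤ j := hb (by simp)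
  have hbk : b ≤ k := hb (by simp)
  set v : Fin S.card → ℤ := nthElt S with hv
  have hvi : Function.Injective v := (S.orderEmbOfFin rfl).injective
  have hvS : Finset.univ.image v = S := Finset.image_orderEmbOfFin_univ S rfl
  have hvmem : ∀ p, v p ∈ S := fun p => Finset.orderEmbOfFin_mem S rfl p
  have hbv : ∀ p, b ≤ v p := fun p => hb (by simp [hvmem p])
  have inj1 : ∀ a, a ∉ S → Function.Injective (Fin.cons a v : Fin (S.card + 1) → ℤ) := by
    intro a ha
    rw [Fin.cons_injective_iff]
    refine ⟨?_, hvi⟩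
    rintro ⟨p, rfl⟩
    exact ha (hvmem p)
  have inj2 : ∀ a c, a ≠ c → a ∉ S → c ∉ S → Function.Injective
      (Fin.cons a (Fin.cons c v : Fin (S.card + 1) → ℤ) : Fin (S.card + 2) → ℤ) := by
    intro a c hac ha hc
    rw [Fin.cons_injective_iff]
    refine ⟨?_, inj1 c hc⟩
    rintro ⟨p, hp⟩
    revert hp
    refine Fin.cases ?_ (fun p => ?_) p
    · simpa using hac.symm
    · rw [Fin.cons_succ]
      rintro rfl
      exact ha (hvmem p)
  have ord1 : ∀ a, b ≤ a → a ∉ S → HasOrder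
      (C (Matrix.vandermonde (Fin.cons a v : Fin (S.card + 1) → ℤ)).det *
        alternant (gtFun b w) (Fin.cons a v : Fin (S.card + 1) → ℤ)) (setWt w (insert a S)) := by
    intro a hba ha
    have := hasOrder_alternant b w _ (inj1 a ha) (Fin.cases hba hbv)
    rwa [image_cons, hvS] at this
  have ord2 : ∀ a c, a ≠ c → b ≤ a → b ≤ c → a ∉ S → c ∉ S → HasOrder
      (C (Matrix.vandermonde (Fin.cons a (Fin.cons c v : Fin (S.card + 1) → ℤ) :
          Fin (S.card + 2) → ℤ)).det *
        alternant (gtFun b w) (Fin.cons a (Fin.cons c v : Fin (S.card + 1) → ℤ) :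
          Fin (S.card + 2) → ℤ)) (setWt w (insert a (insert c S))) := by
    intro a c hac hba hbc ha hc
    have := hasOrder_alternant b w _ (inj2 a c hac ha hc) (Fin.cases hba (Fin.cases hbc hbv))
    rwa [image_cons, image_cons, hvS] at this
  -- In each product of two alternants the Vandermonde factors multiply to `Z` times one difference
  -- `c - a`. Here `Z` is common to all three terms, and the differences are positive because `i < j
  -- < k`; so the sign of `Z` does not matter.
  set Z : ℤ := (∏ p, (v p - i)) * (∏ p, (v p - j)) * (∏ p, (v p - k)) *
    (Matrix.vandermonde v).det ^ 2 with hZ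
  have hprod : ∀ a, a ∉ S → ∏ p, (v p - a) ≠ 0 := by
    intro a ha
    refine Finset.prod_ne_zero_iff.2 fun p _ => sub_ne_zero.2 ?_
    rintro rfl
    exact ha (hvmem p)
  have hZ0 : Z ≠ 0 := mul_ne_zero (mul_ne_zero (mul_ne_zero (hprod i hi) (hprod j hj))
    (hprod k hk)) (pow_ne_zero 2 (Matrix.det_vandermonde_ne_zero_iff.2 hvi))
  have key : ∀ a c e, a < c → a ∉ S → c ∉ S → e ∉ S → b ≤ a → b ≤ c → b ≤ e →
      (∏ p, (v p - a)) * (∏ p, (v p - c)) * (∏ p, (v p - e)) *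
        (Matrix.vandermonde v).det ^ 2 = Z →
      HasOrder (C (c - a) * (C Z * (alternant (gtFun b w)
          (Fin.cons a (Fin.cons c v : Fin (S.card + 1) → ℤ) : Fin (S.card + 2) → ℤ) *
        alternant (gtFun b w) (Fin.cons e v : Fin (S.card + 1) → ℤ))))
        (setWt w (insert a (insert c S)) + setWt w (insert e S)) := by
    intro a c e hac ha hc he hba hbc hbe hZe
    have := (ord2 a c hac.ne hba hbc ha hc).mul (ord1 e hbe he)
    rw [det_vandermonde_cons, det_vandermonde_cons, det_vandermonde_cons,
      Fin.prod_univ_succ] at this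
    simp only [Fin.cons_zero, Fin.cons_succ] at this
    convert this using 1
    rw [← hZe]
    simp only [map_mul, map_pow]
    ring
  refine HasOrder.of_C_mul (sub_pos.2 (hij.trans hjk))
    (key i k j (hij.trans hjk) hi hk hj hbi hbk hbj (by rw [hZ]; ring))
    (sub_pos.2 hij) (sub_pos.2 hjk)
    (key i j k hij hi hj hk hbi hbj hbk (by rw [hZ]))
    (key j k i hjk hj hk hi hbj hbk hbi (by rw [hZ]; ring)) ?_
  rw [← mul_add, alternant_plucker]

/-! ### Edge inequalities from tropical Plücker relations -/

/-- Induction on the width of the window. An element of `S` outside `[i, j]` can be exchanged with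
an endpoint by the Plücker relation, which widens the pair. A missing element between the endpoints
splits the pair into two narrower ones. What remains is a completely filled gap, assumed in `hint`.
-/
theorem edge_of_plucker (W : Finset ℤ → ℤ)
    (hW : ∀ (S : Finset ℤ) (i j k : ℤ), i < j → j < k → i ∉ S → j ∉ S → k ∉ S →
      W (insert i (insert k S)) + W (insert j S) =
        min (W (insert i (insert j S)) + W (insert k S))
          (W (insert j (insert k S)) + W (insert i S)))
    (hint : ∀ i k : ℤ, i < k → W (insert i (Finset.Ioo i k)) + W (insert k (Finset.Ioo i k)) ≤
      W (insert i (insert k (Finset.Ioo i k))) + W (Finset.Ioo i k))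
    (S : Finset ℤ) (i j : ℤ) (hij : i < j) (hi : i ∉ S) (hj : j ∉ S) :
    W (insert i S) + W (insert j S) ≤ W (insert i (insert j S)) + W S := by
  -- the general case follows from the case `S ⊆ Ioo i j`
  have widen : ∀ (d : ℕ), (∀ (S : Finset ℤ) (i k : ℤ), i < k → k - i ≤ d → S ⊆ Finset.Ioo i k →
        W (insert i S) + W (insert k S) ≤ W (insert i (insert k S)) + W S) →
      ∀ (n : ℕ) (S : Finset ℤ) (i j lo hi : ℤ), i < j → hi - lo ≤ d → S ⊆ Finset.Icc lo hi →
        lo ≤ i → j ≤ hi → i ∉ S → j ∉ S → (i - lo) + (hi - j) ≤ n →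
        W (insert i S) + W (insert j S) ≤ W (insert i (insert j S)) + W S := by
    intro d hd n
    induction n with
    | zero =>
      intro S i j lo hi hij hlo hS hloi hjhi hiS hjS hn
      have h1 : i = lo := by push_cast at hn; omega
      have h2 : j = hi := by push_cast at hn; omega
      subst h1 h2
      refine hd S i j hij hlo fun x hx => ?_
      have := Finset.mem_Icc.1 (hS hx)
      have h3 : x ≠ i := fun h => hiS (h ▸ hx)
      have h4 : x ≠ j := fun h => hjS (h ▸ hx)
      rw [Finset.mem_Ioo]
      omega
    | succ n ih =>
      intro S i j lo hi hij hlo hS hloi hjhi hiS hjS hn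
      push_cast at hn
      by_cases hk : ∃ k ∈ S, j < k
      · obtain ⟨k, hkS, hjk⟩ := hk
        obtain ⟨S, hkS', rfl⟩ : ∃ S₀, k ∉ S₀ ∧ S = insert k S₀ :=
          ⟨S.erase k, Finset.notMem_erase _ _, (Finset.insert_erase hkS).symm⟩
        rw [Finset.mem_insert, not_or] at hiS hjS
        rw [Finset.insert_subset_iff, Finset.mem_Icc] at hS
        have h1 := ih (insert j S) i k lo hi (hij.trans hjk) hlo
          (Finset.insert_subset (Finset.mem_Icc.2 ⟨by omega, by omega⟩) hS.2) hloi hS.1.2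
          (by simp [hij.ne, hiS.2]) (by simp [hjk.ne', hkS']) (by omega)
        -- Adding the edge inequality for the wider pair `(i, k)` to one half of the Plücker
        -- relation gives the claim for `(i, j)`.
        have h2 := hW S i j k hij hjk hiS.2 hjS.2 hkS'
        have h3 := min_le_left (W (insert i (insert j S)) + W (insert k S))
          (W (insert j (insert k S)) + W (insert i S))
        rw [Finset.insert_comm k j] at h1
        linarith
      by_cases hk' : ∃ k ∈ S, k < i
      · obtain ⟨k, hkS, hki⟩ := hk'
        obtain ⟨S, hkS', rfl⟩ : ∃ S₀, k ∉ S₀ ∧ S = insert k S₀ :=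
          ⟨S.erase k, Finset.notMem_erase _ _, (Finset.insert_erase hkS).symm⟩
        rw [Finset.mem_insert, not_or] at hiS hjS
        rw [Finset.insert_subset_iff, Finset.mem_Icc] at hS
        have h1 := ih (insert i S) k j lo hi (hki.trans hij) hlo
          (Finset.insert_subset (Finset.mem_Icc.2 ⟨by omega, by omega⟩) hS.2) hS.1.1 hjhi
          (by simp [hki.ne, hkS']) (by simp [hij.ne', hjS.2]) (by omega)
        have h2 := hW S k i j hki hij hkS' hiS.2 hjS.2
        have h3 := min_le_right (W (insert k (insert i S)) + W (insert j S))
          (W (insert i (insert j S)) + W (insert k S))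
        rw [Finset.insert_comm j i, Finset.insert_comm k i (insert j S),
          Finset.insert_comm k j] at h1
        rw [Finset.insert_comm k j S] at h2
        rw [Finset.insert_comm i k S]
        linarith
      · push Not at hk hk'
        refine hd S i j hij (by omega) fun x hx => ?_
        have h1 := hk x hx
        have h2 := hk' x hx
        have h3 : x ≠ i := fun h => hiS (h ▸ hx)
        have h4 : x ≠ j := fun h => hjS (h ▸ hx)
        rw [Finset.mem_Ioo]
        omega
  have main : ∀ (d : ℕ) (S : Finset ℤ) (i k : ℤ), i < k → k - i ≤ d → S ⊆ Finset.Ioo i k →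
      W (insert i S) + W (insert k S) ≤ W (insert i (insert k S)) + W S := by
    intro d
    induction d with
    | zero =>
      intro S i k hik hd
      push_cast at hd
      omega
    | succ d ih =>
      intro S i k hik hd hS
      push_cast at hd
      have hiS : i ∉ S := fun h => by simpa using hS h
      have hkS : k ∉ S := fun h => by simpa using hS h
      by_cases hj : ∃ j ∈ Finset.Ioo i k, j ∉ S
      · obtain ⟨j, hj, hjS⟩ := hj
        rw [Finset.mem_Ioo] at hj
        have h1 := widen d ih ((i - i) + (k - 1 - j)).toNat S i j i (k - 1) hj.1 (by omega)
          (fun x hx => by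
            have := Finset.mem_Ioo.1 (hS hx)
            rw [Finset.mem_Icc]
            omega) le_rfl (by omega) hiS hjS (Int.self_le_toNat _)
        have h2 := widen d ih ((j - (i + 1)) + (k - k)).toNat S j k (i + 1) k hj.2 (by omega)
          (fun x hx => by
            have := Finset.mem_Ioo.1 (hS hx)
            rw [Finset.mem_Icc]
            omega) (by omega) le_rfl hjS hkS (Int.self_le_toNat _)
        have h3 := hW S i j k hj.1 hj.2 hiS hjS hkS
        -- By the edge inequalities for `(i, j)` and `(j, k)`, both arguments of the minimum
        -- dominate the left side.
        have h4 : W (insert i S) + W (insert k S) + W (insert j S) - W S ≤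
            W (insert i (insert k S)) + W (insert j S) := by
          rw [h3]
          exact le_min (by linarith) (by linarith)
        linarith
      · push Not at hj
        rw [hS.antisymm hj]
        exact hint i k hik
  obtain ⟨a, ha⟩ := (insert i (insert j S)).bddBelow
  obtain ⟨c, hc⟩ := (insert i (insert j S)).bddAbove
  refine widen (c - a).toNat (main _) ((i - a) + (c - j)).toNat S i j a c hij
    (Int.self_le_toNat _) (fun x hx => ?_) (ha (by simp)) (hc (by simp)) hi hj
    (Int.self_le_toNat _)
  exact Finset.mem_Icc.2 ⟨ha (by simp [hx]), hc (by simp [hx])⟩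

/-! ### Gluing tableaux -/

theorem IsTab.row_le {u : ℕ} {x : ℕ → ℤ} {C : ℕ → ℕ → ℤ} (h : IsTab u x C) {p q q' : ℕ}
    (hpq : p ≤ q) (hqq : q ≤ q') (hq : q' < u) : C p q ≤ C p q' := by
  induction q', hqq using Nat.le_induction with
  | base => exact le_rfl
  | succ n hn ih => exact (ih (by omega)).trans (h.row p n (by omega) hq)

theorem IsTab.le_apply {u : ℕ} {x : ℕ → ℤ} {C : ℕ → ℕ → ℤ} (h : IsTab u x C) {p q : ℕ}
    (hpq : p ≤ q) (hq : q < u) : x p ≤ C p q := by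
  rw [← h.diag p (by omega)]
  exact h.row_le le_rfl hpq hq

theorem IsTab.col_add_le {u : ℕ} {x : ℕ → ℤ} {C : ℕ → ℕ → ℤ} (h : IsTab u x C) {p q : ℕ}
    (d : ℕ) (hpq : p + d ≤ q) (hq : q < u) : C p q + d ≤ C (p + d) q := by
  induction d with
  | zero => simp
  | succ d ih =>
    have h1 := ih (by omega)
    have h2 := h.col (p + d) q (by omega) hq
    rw [← add_assoc]
    push_cast
    omega

theorem IsTab.apply_add_le {u : ℕ} {x : ℕ → ℤ} {C : ℕ → ℕ → ℤ} (h : IsTab u x C) {p q : ℕ}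
    (hpq : p ≤ q) (hq : q < u) : C p q + ((q - p : ℕ) : ℤ) ≤ x q := by
  have := h.col_add_le (p := p) (q - p) (by omega) hq
  rwa [Nat.add_sub_cancel' hpq, h.diag q hq] at this

theorem tabWt_add (w : ℕ → ℤ → ℕ) (m n : ℕ) (C : ℕ → ℕ → ℤ) :
    tabWt w (m + n) C = tabWt w m C + tabWt w n (fun p q => C (m + p) (m + q)) +
      ∑ q ∈ Finset.range n, ∑ p ∈ Finset.range m, w (m + q - p) (C p (m + q)) := by
  unfold tabWt
  rw [Finset.sum_range_add, add_assoc, ← Finset.sum_add_distrib]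
  congr 1
  refine Finset.sum_congr rfl fun q _ => ?_
  rw [Finset.sum_range_add, add_comm]
  congr 1
  refine Finset.sum_congr rfl fun p hp => ?_
  rw [show m + q - (m + p) = q - p by omega]

theorem tabWt_congr (w : ℕ → ℤ → ℕ) (u : ℕ) {C D : ℕ → ℕ → ℤ}
    (h : ∀ p q, p < q → q < u → C p q = D p q) : tabWt w u C = tabWt w u D := by
  refine Finset.sum_congr rfl fun q hq => Finset.sum_congr rfl fun p hp => ?_
  rw [Finset.mem_range] at hp hq
  rw [h p q hp hq]

/-- If the rectangle `R` can be glued to all tableaux of `A` and `B` and all its entries have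
minimal weight, then the minimal weights add up. -/
theorem setWt_union (w : ℕ → ℤ → ℕ) (A B : Finset ℤ) (hAB : ∀ a ∈ A, ∀ b ∈ B, a < b)
    (R : ℕ → ℕ → ℤ)
    (hrow : ∀ p q, p < A.card → q + 1 < B.card → R p q ≤ R p (q + 1))
    (hcol : ∀ p q, p + 1 < A.card → q < B.card → R p q < R (p + 1) q)
    (hleft : ∀ p < A.card, 0 < B.card →
      elt A (A.card - 1) ≤ R p 0 + ((A.card - 1 - p : ℕ) : ℤ))
    (hbot : ∀ q < B.card, 0 < A.card → R (A.card - 1) q < elt B 0)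
    (hmin : ∀ p q, p < A.card → q < B.card → ∀ c, elt A p ≤ c →
      c + ((A.card + q - p : ℕ) : ℤ) ≤ elt B q →
      w (A.card + q - p) (R p q) ≤ w (A.card + q - p) c) :
    setWt w (A ∪ B) = setWt w A + setWt w B +
      ∑ q ∈ Finset.range B.card, ∑ p ∈ Finset.range A.card, w (A.card + q - p) (R p q) := by
  set m := A.card with hm
  set n := B.card with hn
  let y : ℕ → ℤ := fun p => if p < m then elt A p else elt B (p - m)
  have yA : ∀ p < m, y p = elt A p := fun p hp => by simp [y, hp]
  have yB : ∀ p, y (m + p) = elt B p := fun p => by simp [y]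
  have hdisj : Disjoint A B := Finset.disjoint_left.2 fun a ha hb => (hAB a ha a hb).false
  have hy : ∀ p q, p < q → q < m + n → y p < y q := by
    intro p q hpq hq
    by_cases hqm : q < m
    · rw [yA p (by omega), yA q hqm]
      exact elt_lt hpq (by omega)
    · obtain ⟨q, rfl⟩ := Nat.exists_eq_add_of_le (not_lt.1 hqm)
      rw [yB]
      by_cases hpm : p < m
      · rw [yA p hpm]
        exact hAB _ (elt_mem hpm) _ (elt_mem (by omega))
      · obtain ⟨p, rfl⟩ := Nat.exists_eq_add_of_le (not_lt.1 hpm)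
        rw [yB]
        exact elt_lt (by omega) (by omega)
  symm
  refine IsMinWt.eq_setWt (u := m + n) (x := y) ⟨?_, ?_⟩
    (Finset.card_union_of_disjoint hdisj) ?_ hy
  · obtain ⟨CA, hCA, hA⟩ := (isMinWt_setWt w A).1
    obtain ⟨CB, hCB, hB⟩ := (isMinWt_setWt w B).1
    let C : ℕ → ℕ → ℤ := fun p q =>
      if q < m then CA p q else if p < m then R p (q - m) else CB (p - m) (q - m)
    have C1 : ∀ p q, q < m → C p q = CA p q := fun p q h => by simp [C, h]
    have C2 : ∀ p q, p < m → C p (m + q) = R p q := fun p q h => by simp [C, h]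
    have C3 : ∀ p q, C (m + p) (m + q) = CB p q := fun p q => by simp [C]
    refine ⟨C, ⟨fun p hp => ?_, fun p q hpq hq => ?_, fun p q hpq hq => ?_⟩, ?_⟩
    · by_cases hpm : p < m
      · rw [C1 p p hpm, yA p hpm, hCA.diag p hpm]
      · obtain ⟨p, rfl⟩ := Nat.exists_eq_add_of_le (not_lt.1 hpm)
        rw [C3, yB, hCB.diag p (by omega)]
    · by_cases hqm : q + 1 < m
      · rw [C1 _ _ hqm, C1 p q (by omega)]
        exact hCA.row p q hpq hqm
      by_cases hqm' : q < m
      · have hmq : m = q + 1 := by omega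
        have h1 : C p (q + 1) = R p 0 := by rw [← C2 p 0 (by omega), add_zero, hmq]
        rw [C1 p q hqm', h1]
        -- At the seam, the last column of `CA` is largest when its entries run consecutively up to
        -- the last element of `A`; `hleft` covers this bound.
        have h2 := hCA.apply_add_le hpq (by omega)
        have h3 := hleft p (by omega) (by omega)
        rw [show m - 1 = q by omega] at h3
        omega
      · obtain ⟨q, rfl⟩ := Nat.exists_eq_add_of_le (not_lt.1 hqm')
        by_cases hpm : p < m
        · rw [add_assoc, C2 p q hpm, C2 p (q + 1) hpm]
          exact hrow p q hpm (by omega)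
        · obtain ⟨p, rfl⟩ := Nat.exists_eq_add_of_le (not_lt.1 hpm)
          rw [add_assoc, C3, C3]
          exact hCB.row p q (by omega) (by omega)
    · by_cases hqm : q < m
      · rw [C1 _ _ hqm, C1 _ _ hqm]
        exact hCA.col p q hpq hqm
      obtain ⟨q, rfl⟩ := Nat.exists_eq_add_of_le (not_lt.1 hqm)
      by_cases hpm : p + 1 < m
      · rw [C2 _ _ hpm, C2 p q (by omega)]
        exact hcol p q hpm (by omega)
      by_cases hpm' : p < m
      · have h1 : C (p + 1) (m + q) = CB 0 q := by
          rw [← C3 0 q, add_zero, show m = p + 1 by omega]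
        have h2 := hbot q (by omega) (by omega)
        rw [show m - 1 = p by omega] at h2
        rw [C2 p q hpm', h1]
        exact h2.trans_le
          (hCB.le_apply (Nat.zero_le _) (by omega))
      · obtain ⟨p, rfl⟩ := Nat.exists_eq_add_of_le (not_lt.1 hpm')
        rw [add_assoc, C3, C3]
        exact hCB.col p q (by omega) (by omega)
    · rw [tabWt_add, hA, hB]
      congr 1
      · congr 1
        · exact tabWt_congr w m fun p q _ hq => (C1 p q hq).symm
        · exact tabWt_congr w n fun p q _ _ => (C3 p q).symm
      · refine Finset.sum_congr rfl fun q _ => Finset.sum_congr rfl fun p hp => ?_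
        rw [C2 p q (Finset.mem_range.1 hp)]
  -- Conversely, any tableau of the union restricts to tableaux of `A` and `B`, and `hmin` bounds
  -- each cell of the remaining rectangle.
  · rintro _ ⟨C, hC, rfl⟩
    rw [tabWt_add]
    refine add_le_add (add_le_add ?_ ?_) ?_
    · refine (isMinWt_setWt w A).2 ⟨C, ⟨fun p hp => ?_, fun p q hpq hq => ?_,
        fun p q hpq hq => ?_⟩, rfl⟩
      · rw [hC.diag p (by omega), yA p hp]
      · exact hC.row p q hpq (by omega)
      · exact hC.col p q hpq (by omega)
    · refine (isMinWt_setWt w B).2 ⟨_, ⟨fun p hp => ?_, fun p q hpq hq => ?_,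
        fun p q hpq hq => ?_⟩, rfl⟩
      · rw [hC.diag _ (by omega), yB]
      · exact hC.row (m + p) (m + q) (by omega) (by omega)
      · exact hC.col (m + p) (m + q) (by omega) (by omega)
    · refine Finset.sum_le_sum fun q hq => Finset.sum_le_sum fun p hp => ?_
      rw [Finset.mem_range] at hp hq
      refine hmin p q hp hq _ ?_ ?_
      · rw [← yA p hp]
        exact hC.le_apply (by omega) (by omega)
      · rw [← yB]
        exact hC.apply_add_le (by omega) (by omega)
  · intro p hp
    rw [Finset.mem_union]
    by_cases hpm : p < m
    · rw [yA p hpm]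
      exact Or.inl (elt_mem hpm)
    · obtain ⟨p, rfl⟩ := Nat.exists_eq_add_of_le (not_lt.1 hpm)
      rw [yB]
      exact Or.inr (elt_mem (by omega))

/-- Finite sets which are far apart, for weights vanishing in every window of length `l`. -/
theorem setWt_union_of_gap (w : ℕ → ℤ → ℕ) (l : ℕ)
    (hw : ∀ d, 0 < d → ∀ y : ℤ, ∃ s : ℕ, s < l ∧ w d (y + s) = 0) (A B : Finset ℤ) (c : ℤ)
    (hA : ∀ a ∈ A, a ≤ c) (hB : ∀ b ∈ B, c + l * (A.card + B.card) < b) :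
    setWt w (A ∪ B) = setWt w A + setWt w B := by
  choose! s hs hs' using hw
  -- The cell `(p, q)` receives a zero of its diagonal in the window of length `l` starting at `c +
  -- l (p + q)`. Windows with larger `p + q` lie further right, so rows and columns increase.
  let base : ℕ → ℕ → ℤ := fun p q => c + l * (p + q)
  let R : ℕ → ℕ → ℤ := fun p q => base p q + s (A.card + q - p) (base p q)
  have hR : ∀ p q, p < A.card → q < B.card → w (A.card + q - p) (R p q) = 0 := fun p q hp hq =>
    hs' _ (by omega) _
  have hR1 : ∀ p q, c + l * (p + q) ≤ R p q := fun p q => by simp only [R, base]; omega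
  have hR2 : ∀ p q, p < A.card → R p q < c + l * (p + q + 1) := by
    intro p q hp
    have := hs (A.card + q - p) (by omega) (base p q)
    simp only [R, base] at this ⊢
    rw [mul_add (l : ℤ) (p + q) 1]
    omega
  rw [setWt_union w A B ?_ R, Finset.sum_eq_zero, add_zero]
  · exact fun q hq => Finset.sum_eq_zero fun p hp =>
      hR p q (Finset.mem_range.1 hp) (Finset.mem_range.1 hq)
  · intro p q hp hq
    have h1 := hR1 p (q + 1)
    have h2 := hR2 p q hp
    push_cast at h1
    rw [← add_assoc] at h1
    omega
  · intro p q hp hq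
    have h1 := hR1 (p + 1) q
    have h2 := hR2 p q (by omega)
    push_cast at h1
    rw [add_right_comm] at h1
    omega
  · intro p hp _
    have h1 := hR1 p 0
    have h2 := hA _ (elt_mem (s := A) (p := A.card - 1) (by omega))
    have h3 : (0 : ℤ) ≤ l * (p + (0 : ℕ)) := by positivity
    omega
  · intro q hq hpos
    have h2 := hR2 (A.card - 1) q (by omega)
    have h3 := hB _ (elt_mem (s := B) (p := 0) (by omega))
    have h4 : (l : ℤ) * ((A.card - 1 : ℕ) + q + 1) ≤ l * (A.card + B.card) :=
      mul_le_mul_of_nonneg_left (by omega) (by positivity)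
    omega
  · intro p q hp hq c _ _
    rw [hR p q hp hq]
    exact Nat.zero_le _
  · intro a ha b hb
    have h1 := hA a ha
    have h2 := hB b hb
    have h3 : (0 : ℤ) ≤ l * (A.card + B.card) := by positivity
    omega

/-! ### Sorted elements, runs of consecutive integers, and adding extreme elements -/

theorem sum_elt {M : Type*} [AddCommMonoid M] (s : Finset ℤ) (f : ℤ → M) :
    ∑ j ∈ s, f j = ∑ q ∈ Finset.range s.card, f (elt s q) := by
  conv_lhs => rw [← image_elt s]
  refine Finset.sum_image fun p hp q hq hpq => ?_
  simp only [Finset.coe_range, Set.mem_Iio] at hp hq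
  rcases lt_trichotomy p q with h | h | h
  · exact absurd hpq (elt_lt h hq).ne
  · exact h
  · exact absurd hpq (elt_lt h hp).ne'

theorem exists_elt_eq {s : Finset ℤ} {x : ℤ} (hx : x ∈ s) : ∃ p < s.card, elt s p = x := by
  rw [← image_elt s] at hx
  obtain ⟨p, hp, rfl⟩ := Finset.mem_image.1 hx
  exact ⟨p, Finset.mem_range.1 hp, rfl⟩

theorem add_le_elt {s : Finset ℤ} {lo : ℤ} (hs : ∀ j ∈ s, lo ≤ j) {q : ℕ} (hq : q < s.card) :
    lo + q ≤ elt s q := by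
  induction q with
  | zero => simpa using hs _ (elt_mem hq)
  | succ q ih =>
    have h1 := ih (by omega)
    have h2 := elt_lt (Nat.lt_succ_self q) hq
    push_cast
    rw [Nat.succ_eq_add_one] at h2
    omega

theorem elt_le_sub {s : Finset ℤ} {hi : ℤ} (hs : ∀ j ∈ s, j < hi) {q d : ℕ}
    (hq : q + d + 1 = s.card) : elt s q + d < hi := by
  induction d generalizing q with
  | zero => simpa using hs _ (elt_mem (by omega))
  | succ d ih =>
    have h1 := ih (q := q + 1) (by omega)
    have h2 := elt_lt (s := s) (Nat.lt_succ_self q) (by omega)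
    push_cast
    rw [Nat.succ_eq_add_one] at h2
    omega

theorem elt_eq_add {s : Finset ℤ} {lo : ℤ} (hs : ∀ j ∈ s, lo ≤ j) {N : ℕ}
    (hN : Finset.Ico lo (lo + N) ⊆ s) (q : ℕ) (hq : q < N) : elt s q = lo + q := by
  induction q using Nat.strong_induction_on with
  | _ q ih =>
    obtain ⟨r, hr, hrq⟩ := exists_elt_eq (hN (Finset.mem_Ico.2 ⟨by omega, by omega⟩) :
      lo + q ∈ s)
    have h1 := add_le_elt hs hr
    rcases (show r ≤ q by omega).eq_or_lt with rfl | hlt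
    · exact hrq
    · have := ih r hlt (by omega)
      omega

theorem elt_eq_sub {s : Finset ℤ} {hi : ℤ} (hs : ∀ j ∈ s, j < hi) {N : ℕ}
    (hN : Finset.Ico (hi - N) hi ⊆ s) (d : ℕ) : ∀ q, q + d + 1 = s.card → d < N →
      elt s q = hi - d - 1 := by
  induction d using Nat.strong_induction_on with
  | _ d ih =>
    intro q hq hd
    obtain ⟨r, hr, hrq⟩ := exists_elt_eq (hN (Finset.mem_Ico.2 ⟨by omega, by omega⟩) :
      hi - d - 1 ∈ s)
    obtain ⟨e, he⟩ : ∃ e, r + e + 1 = s.card := ⟨s.card - r - 1, by omega⟩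
    have h1 := elt_le_sub hs he
    rcases (show e ≤ d by omega).eq_or_lt with rfl | hlt
    · rwa [show q = r by omega]
    · have := ih e hlt r he (by omega)
      omega

/-- The weights of a family indexed by pairs `i < j`. -/
def diagWt (a : ℤ → ℤ → ℕ) : ℕ → ℤ → ℕ := fun d c => a c (c + d)

/-- Adding a smallest element. -/
theorem setWt_insert_left (a : ℤ → ℤ → ℕ) (x : ℤ) (s : Finset ℤ) (hs : ∀ j ∈ s, x < j)
    (h : ∀ q < s.card, elt s q = x + 1 + q ∨ ∀ i j : ℤ, (q : ℤ) < j - i → a i j = 0) :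
    setWt (diagWt a) (insert x s) = setWt (diagWt a) s + ∑ j ∈ s, a x j := by
  have hx : elt {x} 0 = x := by
    have := elt_mem (s := {x}) (p := 0) (by simp)
    simpa using this
  have h0 : setWt (diagWt a) {x} = 0 := by
    obtain ⟨C, hC, hn⟩ := (isMinWt_setWt (diagWt a) {x}).1
    rw [hn]
    simp [tabWt]
  -- The new first row is constantly `x`. In each column either the run forces this entry, or the
  -- diagonal is so far out that its weight vanishes.
  rw [Finset.insert_eq, setWt_union _ _ _ ?_ (fun _ _ => x), h0, zero_add]
  · congr 1
    rw [sum_elt]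
    refine Finset.sum_congr rfl fun q hq => ?_
    rw [Finset.mem_range] at hq
    rw [Finset.card_singleton, Finset.sum_range_one, diagWt]
    rcases h q hq with h1 | h1
    · rw [h1]
      congr 1
      omega
    · have := add_le_elt (s := s) (lo := x + 1) (fun j hj => by have := hs j hj; omega) hq
      rw [h1 _ _ (by omega), h1 _ _ (by omega)]
  · exact fun _ _ _ _ => le_rfl
  · intro p q hp
    rw [Finset.card_singleton] at hp
    omega
  · intro p hp _
    simp [hx]
  · intro q hq _
    exact hs _ (elt_mem (by omega))
  · intro p q hp hq c hc hc'
    rw [Finset.card_singleton] at hp hc' ⊢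
    obtain rfl : p = 0 := by omega
    rw [hx] at hc
    rcases h q hq with h1 | h1
    · rw [show c = x by omega]
    · rw [diagWt, h1 _ _ (by omega)]
      exact Nat.zero_le _
  · intro b hb j hj
    rw [Finset.mem_singleton.1 hb]
    exact hs j hj

/-- Adding a largest element. -/
theorem setWt_insert_right (a : ℤ → ℤ → ℕ) (N : ℕ) (ha : ∀ i j : ℤ, (N : ℤ) ≤ j - i → a i j = 0)
    (y : ℤ) (s : Finset ℤ) (hs : ∀ j ∈ s, j < y) (h : Finset.Ico (y - N) y ⊆ s) (lo : ℤ)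
    (hlo : lo ≤ y - N) :
    setWt (diagWt a) (insert y s) = setWt (diagWt a) s + ∑ i ∈ Finset.Ico lo y, a i y := by
  have hy : elt {y} 0 = y := by
    have := elt_mem (s := {y}) (p := 0) (by simp)
    simpa using this
  have h0 : setWt (diagWt a) {y} = 0 := by
    obtain ⟨C, hC, hn⟩ := (isMinWt_setWt (diagWt a) {y}).1
    rw [hn]
    simp [tabWt]
  have hcard : N ≤ s.card := by simpa using Finset.card_le_card h
  -- The new last column consists of consecutive integers ending just below `y`, so its weights are
  -- `a i y`. The lowest `N` of these entries in the column are forced by the run; the others have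
  -- weight zero.
  rw [Finset.insert_eq, Finset.union_comm,
    setWt_union _ _ _ ?_ (fun p _ => y - ((s.card - p : ℕ) : ℤ)), h0, add_zero]
  · congr 1
    rw [Finset.card_singleton, Finset.sum_range_one]
    have h1 : ∑ i ∈ Finset.Ico lo y, a i y = ∑ i ∈ Finset.Ico (y - N) y, a i y := by
      symm
      refine Finset.sum_subset (Finset.Ico_subset_Ico_left hlo) fun i hi hi' => ?_
      rw [Finset.mem_Ico] at hi hi'
      exact ha i y (by omega)
    have h2 : ∑ i ∈ Finset.Ico (y - s.card) y, a i y = ∑ i ∈ Finset.Ico (y - N) y, a i y := by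
      symm
      refine Finset.sum_subset (Finset.Ico_subset_Ico_left (by omega)) fun i hi hi' => ?_
      rw [Finset.mem_Ico] at hi hi'
      exact ha i y (by omega)
    rw [h1, ← h2]
    refine Finset.sum_bij (fun p _ => y - ((s.card - p : ℕ) : ℤ)) ?_ ?_ ?_ ?_
    · intro p hp
      rw [Finset.mem_range] at hp
      rw [Finset.mem_Ico]
      omega
    · intro p hp q hq hpq
      rw [Finset.mem_range] at hp hq
      omega
    · intro i hi
      rw [Finset.mem_Ico] at hi
      exact ⟨s.card - (y - i).toNat, by rw [Finset.mem_range]; omega, by omega⟩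
    · intro p hp
      rw [diagWt]
      congr 1
      rw [add_zero]
      omega
  · exact fun _ _ _ _ => le_rfl
  · intro p q hp _
    omega
  · intro p hp _
    have := hs _ (elt_mem (s := s) (p := s.card - 1) (by omega))
    omega
  · intro q hq hpos
    rw [hy]
    omega
  · intro p q hp hq c hc hc'
    rw [Finset.card_singleton] at hq
    obtain rfl : q = 0 := by omega
    rw [hy] at hc'
    by_cases hN : s.card - p ≤ N
    · have h1 := elt_eq_sub hs h (s.card - p - 1) p (by omega) (by omega)
      rw [show c = y - ((s.card - p : ℕ) : ℤ) by omega]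
    · rw [diagWt, ha _ _ (by omega)]
      exact Nat.zero_le _
  · intro j hj b hb
    rw [Finset.mem_singleton.1 hb]
    exact hs j hj

theorem setWt_empty (w : ℕ → ℤ → ℕ) : setWt w ∅ = 0 := by
  obtain ⟨C, -, hn⟩ := (isMinWt_setWt w ∅).1
  rw [hn]
  simp [tabWt]

theorem elt_Ico (lo hi : ℤ) (q : ℕ) (hq : q < (Finset.Ico lo hi).card) :
    elt (Finset.Ico lo hi) q = lo + q := by
  rw [Int.card_Ico] at hq
  refine elt_eq_add (N := (hi - lo).toNat) (fun j hj => (Finset.mem_Ico.1 hj).1) ?_ q hq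
  exact Finset.Ico_subset_Ico_right (by omega)

/-- An interval leaves no freedom in any cell. Hence `M` vanishes on intervals, which gives the
normalization (0) and matches `M_∅ = M_Ĩ = 0`. -/
theorem setWt_Ico (a : ℤ → ℤ → ℕ) (lo : ℤ) (n : ℕ) :
    setWt (diagWt a) (Finset.Ico lo (lo + n)) =
      ∑ j ∈ Finset.Ico lo (lo + n), ∑ i ∈ Finset.Ico lo j, a i j := by
  induction n generalizing lo with
  | zero => simp [setWt_empty]
  | succ n ih =>
    have h1 : Finset.Ico lo (lo + (n + 1 : ℕ)) =
        insert lo (Finset.Ico (lo + 1) (lo + 1 + n)) := by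
      ext x
      simp only [Finset.mem_insert, Finset.mem_Ico]
      push_cast
      omega
    have h2 : lo ∉ Finset.Ico (lo + 1) (lo + 1 + n) := by simp
    rw [h1, setWt_insert_left, ih, Finset.sum_insert h2, Finset.Ico_self, Finset.sum_empty,
      zero_add, ← Finset.sum_add_distrib]
    · refine Finset.sum_congr rfl fun j hj => ?_
      rw [Finset.mem_Ico] at hj
      have h3 : Finset.Ico lo j = insert lo (Finset.Ico (lo + 1) j) := by
        ext x
        simp only [Finset.mem_insert, Finset.mem_Ico]
        omega
      rw [h3, Finset.sum_insert (by simp), add_comm]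
    · intro j hj
      rw [Finset.mem_Ico] at hj
      omega
    · exact fun q hq => Or.inl (elt_Ico _ _ q hq)

/-! ### Edge inequalities and Plücker relations for `M` -/

/-- The linear part of `-M`, for an interval starting at `lo`. -/
noncomputable def linPart (a : ℤ → ℤ → ℕ) (lo : ℤ) (s : Finset ℤ) : ℕ :=
  ∑ j ∈ s, ∑ i ∈ Finset.Ico lo j, a i j

/-- The integer `M_s(a)` for an interval starting at `lo`. -/
noncomputable def mVal (a : ℤ → ℤ → ℕ) (lo : ℤ) (s : Finset ℤ) : ℤ :=
  -(linPart a lo s : ℤ) + setWt (diagWt a) s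

theorem linPart_insert (a : ℤ → ℤ → ℕ) (lo : ℤ) {x : ℤ} {s : Finset ℤ} (hx : x ∉ s) :
    linPart a lo (insert x s) = ∑ i ∈ Finset.Ico lo x, a i x + linPart a lo s :=
  Finset.sum_insert hx

theorem setWt_Ico_eq_linPart (a : ℤ → ℤ → ℕ) (lo hi : ℤ) :
    setWt (diagWt a) (Finset.Ico lo hi) = linPart a lo (Finset.Ico lo hi) := by
  rcases le_total lo hi with h | h
  · obtain ⟨n, rfl⟩ : ∃ n : ℕ, hi = lo + n := ⟨(hi - lo).toNat, by omega⟩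
    exact setWt_Ico a lo n
  · rw [Finset.Ico_eq_empty (by omega), setWt_empty]
    rfl

theorem mVal_Ico (a : ℤ → ℤ → ℕ) (lo hi : ℤ) : mVal a lo (Finset.Ico lo hi) = 0 := by
  rw [mVal, setWt_Ico_eq_linPart, neg_add_cancel]

theorem setWt_edge (a : ℤ → ℤ → ℕ) (S : Finset ℤ) {i j : ℤ} (hij : i < j) (hi : i ∉ S)
    (hj : j ∉ S) : setWt (diagWt a) (insert i S) + setWt (diagWt a) (insert j S) ≤
      setWt (diagWt a) (insert i (insert j S)) + setWt (diagWt a) S := by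
  have := edge_of_plucker (fun s => (setWt (diagWt a) s : ℤ)) ?_ ?_ S i j hij hi hj
  · exact_mod_cast this
  · intro S i j k hij hjk hi hj hk
    exact_mod_cast setWt_plucker (diagWt a) S hij hjk hi hj hk
  · intro i k hik
    -- All four sets are intervals with explicit weights; the two sides differ by `a i k ≥ 0`.
    have e1 : insert i (Finset.Ioo i k) = Finset.Ico i k := Finset.Ioo_insert_left hik
    have e2 : insert k (Finset.Ioo i k) = Finset.Ico (i + 1) (k + 1) := by
      ext x
      simp only [Finset.mem_insert, Finset.mem_Ico, Finset.mem_Ioo]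
      omega
    have e3 : insert i (insert k (Finset.Ioo i k)) = Finset.Ico i (k + 1) := by
      ext x
      simp only [Finset.mem_insert, Finset.mem_Ico, Finset.mem_Ioo]
      omega
    have e4 : Finset.Ioo i k = Finset.Ico (i + 1) k := by
      ext x
      simp only [Finset.mem_Ico, Finset.mem_Ioo]
      omega
    have f1 : setWt (diagWt a) (insert i (Finset.Ioo i k)) =
        linPart a i (insert i (Finset.Ioo i k)) := by rw [e1, setWt_Ico_eq_linPart]
    have f2 : setWt (diagWt a) (insert k (Finset.Ioo i k)) =
        linPart a (i + 1) (insert k (Finset.Ioo i k)) := by rw [e2, setWt_Ico_eq_linPart]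
    have f3 : setWt (diagWt a) (insert i (insert k (Finset.Ioo i k))) =
        linPart a i (insert i (insert k (Finset.Ioo i k))) := by rw [e3, setWt_Ico_eq_linPart]
    have f4 : setWt (diagWt a) (Finset.Ioo i k) = linPart a (i + 1) (Finset.Ioo i k) := by
      rw [e4, setWt_Ico_eq_linPart]
    have hle : ∑ x ∈ Finset.Ico (i + 1) k, a x k ≤ ∑ x ∈ Finset.Ico i k, a x k :=
      Finset.sum_le_sum_of_subset (Finset.Ico_subset_Ico_left (by omega))
    simp only [f1, f2, f3, f4]
    rw [linPart_insert a i (by simp), linPart_insert a (i + 1) (by simp),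
      linPart_insert a i (by simp [hik.ne]), linPart_insert a i (by simp)]
    push_cast
    have hle' : (∑ x ∈ Finset.Ico (i + 1) k, (a x k : ℤ)) ≤ ∑ x ∈ Finset.Ico i k, (a x k : ℤ) :=
      mod_cast hle
    linarith

theorem mVal_edge (a : ℤ → ℤ → ℕ) (lo : ℤ) (S : Finset ℤ) {i j : ℤ} (hij : i ≠ j) (hi : i ∉ S)
    (hj : j ∉ S) : mVal a lo (insert i S) + mVal a lo (insert j S) ≤
      mVal a lo (insert i (insert j S)) + mVal a lo S := by
  wlog hlt : i < j generalizing i j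
  · rw [add_comm, Finset.insert_comm]
    exact this hij.symm hj hi (by omega)
  have := setWt_edge a S hlt hi hj
  simp only [mVal]
  rw [linPart_insert a lo (x := i) (s := insert j S) (by simp [hij, hi]), linPart_insert a lo hi,
    linPart_insert a lo hj]
  omega

theorem mVal_plucker (a : ℤ → ℤ → ℕ) (lo : ℤ) (S : Finset ℤ) {i j k : ℤ} (hij : i < j)
    (hjk : j < k) (hi : i ∉ S) (hj : j ∉ S) (hk : k ∉ S) :
    mVal a lo (insert i (insert k S)) + mVal a lo (insert j S) =
      min (mVal a lo (insert i (insert j S)) + mVal a lo (insert k S))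
        (mVal a lo (insert j (insert k S)) + mVal a lo (insert i S)) := by
  have := setWt_plucker (diagWt a) S hij hjk hi hj hk
  simp only [mVal]
  rw [linPart_insert a lo (x := i) (s := insert j S) (by simp [hij.ne, hi]),
    linPart_insert a lo (x := i) (s := insert k S) (by simp [(hij.trans hjk).ne, hi]),
    linPart_insert a lo (x := j) (s := insert k S) (by simp [hjk.ne, hj]),
    linPart_insert a lo hi, linPart_insert a lo hj, linPart_insert a lo hk]
  omega

/-! ### Dependence of `M` on the interval -/

/-- The weight and the linear part both grow by `∑ j ∈ s, a (lo - 1) j`. -/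
theorem mVal_insert_left (a : ℤ → ℤ → ℕ) {N : ℕ} (ha : ∀ i j : ℤ, (N : ℤ) ≤ j - i → a i j = 0)
    (lo : ℤ) (s : Finset ℤ) (hs : ∀ j ∈ s, lo ≤ j) (hN : Finset.Ico lo (lo + N) ⊆ s) :
    mVal a (lo - 1) (insert (lo - 1) s) = mVal a lo s := by
  have h1 : lo - 1 ∉ s := fun h => by have := hs _ h; omega
  have h2 := setWt_insert_left a (lo - 1) s (fun j hj => by have := hs j hj; omega) (by
    intro q hq
    by_cases hqN : q < N
    · left
      rw [elt_eq_add hs hN q hqN]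
      omega
    · exact Or.inr fun i j hij => ha i j (by omega))
  have h3 : linPart a (lo - 1) s = ∑ j ∈ s, a (lo - 1) j + linPart a lo s := by
    rw [linPart, linPart, ← Finset.sum_add_distrib]
    refine Finset.sum_congr rfl fun j hj => ?_
    have h4 : Finset.Ico (lo - 1) j = insert (lo - 1) (Finset.Ico lo j) := by
      have := hs j hj
      ext x
      simp only [Finset.mem_insert, Finset.mem_Ico]
      omega
    rw [h4, Finset.sum_insert (by simp)]
  rw [mVal, mVal, linPart_insert a _ h1, h2, h3, Finset.Ico_self, Finset.sum_empty]
  push_cast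
  ring

theorem mVal_extend (a : ℤ → ℤ → ℕ) {N : ℕ} (ha : ∀ i j : ℤ, (N : ℤ) ≤ j - i → a i j = 0)
    (lo : ℤ) (s : Finset ℤ) (hs : ∀ j ∈ s, lo ≤ j) (hN : Finset.Ico lo (lo + N) ⊆ s)
    {lo' : ℤ} (hlo : lo' ≤ lo) : mVal a lo' (Finset.Ico lo' lo ∪ s) = mVal a lo s := by
  obtain ⟨n, rfl⟩ : ∃ n : ℕ, lo' = lo - n := ⟨(lo - lo').toNat, by omega⟩
  clear hlo
  induction n with
  | zero => simp
  | succ n ih =>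
    rw [← ih, ← mVal_insert_left a ha (lo - n)]
    · have e1 : lo - (n + 1 : ℕ) = lo - n - 1 := by push_cast; ring
      rw [e1, ← Finset.insert_union]
      congr 2
      ext x
      simp only [Finset.mem_insert, Finset.mem_Ico]
      omega
    · intro j hj
      rcases Finset.mem_union.1 hj with hj | hj
      · exact (Finset.mem_Ico.1 hj).1
      · have := hs j hj
        omega
    · intro x hx
      rw [Finset.mem_Ico] at hx
      by_cases h : x < lo
      · exact Finset.mem_union_left _ (Finset.mem_Ico.2 ⟨hx.1, h⟩)
      · exact Finset.mem_union_right _ (hN (Finset.mem_Ico.2 ⟨by omega, by omega⟩))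

theorem mVal_insert_right (a : ℤ → ℤ → ℕ) {N : ℕ} (ha : ∀ i j : ℤ, (N : ℤ) ≤ j - i → a i j = 0)
    (lo y : ℤ) (s : Finset ℤ) (hs : ∀ j ∈ s, j < y) (hN : Finset.Ico (y - N) y ⊆ s)
    (hlo : lo ≤ y - N) : mVal a lo (insert y s) = mVal a lo s := by
  rw [mVal, mVal, setWt_insert_right a N ha y s hs hN lo hlo,
    linPart_insert a lo (fun h => (hs y h).false)]
  push_cast
  ring

theorem linPart_eq_of_le (a : ℤ → ℤ → ℕ) {N : ℕ} (ha : ∀ i j : ℤ, (N : ℤ) ≤ j - i → a i j = 0)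
    (lo : ℤ) (s : Finset ℤ) (hs : ∀ j ∈ s, lo ≤ j - N) :
    linPart a lo s = ∑ j ∈ s, ∑ i ∈ Finset.Ico (j - N) j, a i j := by
  refine Finset.sum_congr rfl fun j hj => ?_
  symm
  refine Finset.sum_subset (Finset.Ico_subset_Ico_left (hs j hj)) fun i hi hi' => ?_
  rw [Finset.mem_Ico] at hi hi'
  exact ha i j (by omega)

/-- The run of length `N` stands for `ℤ_{< n}`. Its weight cancels its linear part, and the gap
decouples it from `B`, so `n` disappears from the value. -/
theorem mVal_Ico_union_of_gap (a : ℤ → ℤ → ℕ) {N l : ℕ}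
    (ha : ∀ i j : ℤ, (N : ℤ) ≤ j - i → a i j = 0)
    (hw : ∀ d, 0 < d → ∀ y : ℤ, ∃ s : ℕ, s < l ∧ diagWt a d (y + s) = 0) (n : ℤ)
    (B : Finset ℤ) (hB : ∀ b ∈ B, n + l * (N + B.card) ≤ b) :
    mVal a (n - N) (Finset.Ico (n - N) n ∪ B) =
      -((∑ j ∈ B, ∑ i ∈ Finset.Ico (j - N) j, a i j : ℕ) : ℤ) + setWt (diagWt a) B := by
  have hcard : (Finset.Ico (n - N) n).card = N := by simp
  have hpos : (0 : ℤ) ≤ l * (N + B.card) := by positivity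
  have hlt : ∀ b ∈ B, n ≤ b := fun b hb => by have := hB b hb; omega
  have hdisj : Disjoint (Finset.Ico (n - N) n) B := Finset.disjoint_left.2 fun x hx hx' => by
    have h1 := hlt x hx'
    have h2 := Finset.mem_Ico.1 hx
    omega
  have h1 := setWt_union_of_gap (diagWt a) l hw (Finset.Ico (n - N) n) B (n - 1)
    (fun x hx => by have := Finset.mem_Ico.1 hx; omega)
    (fun b hb => by have := hB b hb; rw [hcard]; omega)
  have h2 : linPart a (n - N) (Finset.Ico (n - N) n ∪ B) =
      linPart a (n - N) (Finset.Ico (n - N) n) + linPart a (n - N) B :=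
    Finset.sum_union hdisj
  rw [mVal, h1, h2, setWt_Ico_eq_linPart, linPart_eq_of_le a ha (n - N) B
    (fun j hj => by have := hlt j hj; omega)]
  push_cast
  ring

/-! ### Translation invariance -/

theorem setWt_image_add (a : ℤ → ℤ → ℕ) (t : ℤ) (ha : ∀ i j, a (i + t) (j + t) = a i j)
    (s : Finset ℤ) : setWt (diagWt a) (s.image (· + t)) = setWt (diagWt a) s := by
  have hwt : ∀ u C, tabWt (diagWt a) u (fun p q => C p q + t) = tabWt (diagWt a) u C := by
    intro u C
    refine Finset.sum_congr rfl fun q _ => Finset.sum_congr rfl fun p _ => ?_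
    simp only [diagWt]
    rw [add_right_comm, ha]
  symm
  refine IsMinWt.eq_setWt (u := s.card) (x := fun p => elt s p + t) ⟨?_, ?_⟩
    (Finset.card_image_of_injective _ (add_left_injective t)) ?_ ?_
  · obtain ⟨C, hC, hn⟩ := (isMinWt_setWt (diagWt a) s).1
    refine ⟨fun p q => C p q + t, ⟨fun p hp => ?_, fun p q hpq hq => ?_, fun p q hpq hq => ?_⟩, ?_⟩
    · rw [hC.diag p hp]
    · exact add_le_add_left (hC.row p q hpq hq) t
    · exact add_lt_add_left (hC.col p q hpq hq) t
    · rw [hwt, hn]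
  · rintro _ ⟨C, hC, rfl⟩
    refine (isMinWt_setWt (diagWt a) s).2 ⟨fun p q => C p q - t,
      ⟨fun p hp => ?_, fun p q hpq hq => ?_, fun p q hpq hq => ?_⟩, ?_⟩
    · rw [hC.diag p hp, add_sub_cancel_right]
    · exact sub_le_sub_right (hC.row p q hpq hq) t
    · exact sub_lt_sub_right (hC.col p q hpq hq) t
    · rw [← hwt s.card fun p q => C p q - t]
      simp only [sub_add_cancel]
  · intro p hp
    exact Finset.mem_image_of_mem _ (elt_mem hp)
  · intro p q hpq hq
    exact add_lt_add_left (elt_lt hpq hq) t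

theorem mVal_image_add (a : ℤ → ℤ → ℕ) (t : ℤ) (ha : ∀ i j, a (i + t) (j + t) = a i j)
    (lo : ℤ) (s : Finset ℤ) : mVal a (lo + t) (s.image (· + t)) = mVal a lo s := by
  rw [mVal, mVal, setWt_image_add a t ha, linPart, linPart,
    Finset.sum_image fun x _ y _ h => add_left_injective t h]
  congr 3
  refine Finset.sum_congr rfl fun j _ => ?_
  rw [← Finset.sum_Ico_add']
  exact Finset.sum_congr rfl fun i _ => ha i j

/-! ### Comparison with the definitions for Lusztig data -/

/-- The entries of `a`, extended by `0`. -/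
def fullEntry (a : LusztigZ) (i j : ℤ) : ℕ := if h : i < j then a.1 ⟨(i, j), h⟩ else 0

theorem fullEntry_of_lt (a : LusztigZ) {i j : ℤ} (h : i < j) :
    fullEntry a i j = a.1 ⟨(i, j), h⟩ := dif_pos h

theorem exists_fullEntry_eq_zero (a : LusztigZ) :
    ∃ N : ℕ, 0 < N ∧ ∀ i j : ℤ, (N : ℤ) ≤ j - i → fullEntry a i j = 0 := by
  obtain ⟨N, hN, h⟩ := a.2
  exact ⟨N, hN, fun i j hij => by rw [fullEntry_of_lt a (by omega)]; exact h _ hij⟩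

theorem entry_restrictLusztig (a : LusztigZ) {I : FinInterval} {i j : ℤ} (hi : i ∈ tilde I)
    (hj : j ∈ tilde I) : entry (restrictLusztig a I) i j = fullEntry a i j := by
  by_cases h : i < j
  · rw [fullEntry_of_lt a h, entry, dif_pos ⟨hi, hj, h⟩]
    rfl
  · rw [fullEntry, dif_neg h, entry, dif_neg fun h' => h h'.2.2]

theorem sum_Ioi_fin (u : ℕ) (f : ℕ → ℕ → ℕ) :
    ∑ p : Fin u, ∑ q ∈ Finset.Ioi p, f p q =
      ∑ q ∈ Finset.range u, ∑ p ∈ Finset.range q, f p q := by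
  have h1 : ∀ p : Fin u, ∑ q ∈ Finset.Ioi p, f p q =
      ∑ q : Fin u, if (p : ℕ) < q then f p q else 0 := by
    intro p
    rw [← Finset.sum_filter]
    refine Finset.sum_congr ?_ fun _ _ => rfl
    ext q
    simp
  rw [Finset.sum_congr rfl fun p _ => h1 p, Finset.sum_comm, Finset.sum_range]
  refine Finset.sum_congr rfl fun q _ => ?_
  rw [← Finset.sum_range (fun p => if p < (q : ℕ) then f p q else 0), ← Finset.sum_filter]
  refine Finset.sum_congr ?_ fun _ _ => rfl
  ext p
  have := q.2
  simp only [Finset.mem_filter, Finset.mem_range]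
  omega

theorem tableauWeight_eq (a : LusztigZ) (I : FinInterval) (s : Finset ℤ) (hs : s ⊆ tilde I)
    {C : ℕ → ℕ → ℤ} (hC : IsTab s.card (elt s) C) :
    tableauWeight (restrictLusztig a I) s (fun p q => C p q) =
      tabWt (diagWt (fullEntry a)) s.card C := by
  have h1 : ∀ p q : Fin s.card, q ∈ Finset.Ioi p →
      entry (restrictLusztig a I) (C p q) (C p q + (((q : ℕ) : ℤ) - ((p : ℕ) : ℤ))) =
        diagWt (fullEntry a) ((q : ℕ) - (p : ℕ)) (C p q) := by
    intro p q hpq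
    rw [Finset.mem_Ioi, Fin.lt_def] at hpq
    -- Both indices of a cell lie between two elements of `s`, hence in `tilde I`, so the default
    -- value of `entry` is not reached.
    have h2 := hC.le_apply hpq.le q.2
    have h3 := hC.apply_add_le hpq.le q.2
    have h4 := hs (elt_mem p.2)
    have h5 := hs (elt_mem q.2)
    rw [tilde, Finset.mem_Icc] at h4 h5
    rw [entry_restrictLusztig, diagWt, Nat.cast_sub hpq.le]
    · rw [tilde, Finset.mem_Icc]
      omega
    · rw [tilde, Finset.mem_Icc]
      omega
  rw [tableauWeight, Finset.sum_congr rfl fun p _ => Finset.sum_congr rfl (h1 p)]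
  exact sum_Ioi_fin s.card fun p q => diagWt (fullEntry a) (q - p) (C p q)

theorem minWeight_eq (a : LusztigZ) (I : FinInterval) (s : Finset ℤ) (hs : s ⊆ tilde I) :
    minWeight (restrictLusztig a I) s = setWt (diagWt (fullEntry a)) s := by
  refine (isLeast_minWeight (restrictLusztig a I) s).unique ⟨?_, ?_⟩
  · obtain ⟨C, hC, hn⟩ := (isMinWt_setWt (diagWt (fullEntry a)) s).1
    refine ⟨fun p q => C p q, ⟨fun p => ?_, fun p q q' hpq hqq => ?_, fun p p' q hpp hpq => ?_⟩, ?_⟩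
    · rw [hC.diag p p.2, elt_val]
    · exact hC.row_le hpq hqq q'.2
    · rw [Fin.lt_def] at hpp
      rw [Fin.le_def] at hpq
      have := hC.col_add_le (p := p) (q := q) (p' - p) (by omega) q.2
      rw [Nat.add_sub_cancel' hpp.le] at this
      omega
    · rw [hn, tableauWeight_eq a I s hs hC]
  · rintro _ ⟨C, hC, rfl⟩
    let D : ℕ → ℕ → ℤ := fun p q =>
      if h : p < s.card ∧ q < s.card then C ⟨p, h.1⟩ ⟨q, h.2⟩ else 0
    have hD : ∀ p q (hp : p < s.card) (hq : q < s.card), D p q = C ⟨p, hp⟩ ⟨q, hq⟩ :=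
      fun p q hp hq => dif_pos ⟨hp, hq⟩
    have hD' : C = fun p q : Fin s.card => D p q := by
      ext p q
      rw [hD p q p.2 q.2]
    have hDt : IsTab s.card (elt s) D := by
      refine ⟨fun p hp => ?_, fun p q hpq hq => ?_, fun p q hpq hq => ?_⟩
      · rw [hD p p hp hp, hC.diag, elt, dif_pos hp]
      · rw [hD p q (by omega) (by omega), hD p (q + 1) (by omega) hq]
        exact hC.row _ _ _ hpq (Nat.le_succ q)
      · rw [hD p q (by omega) hq, hD (p + 1) q (by omega) hq]
        exact hC.col _ _ _ (Nat.lt_succ_self p) hpq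
    refine (isMinWt_setWt (diagWt (fullEntry a)) s).2 ⟨D, hDt, ?_⟩
    rw [← tableauWeight_eq a I s hs hDt, ← hD']

theorem MFin_eq (a : LusztigZ) (I : FinInterval) (s : Finset ℤ) (hs : s ⊆ tilde I) :
    MFin (restrictLusztig a I) s = mVal (fullEntry a) I.fst s := by
  rw [MFin, mVal, minWeight_eq a I s hs, linPart]
  congr 2
  push_cast
  refine Finset.sum_congr rfl fun j hj => Finset.sum_congr rfl fun i hi => ?_
  have h1 := hs hj
  rw [entry_restrictLusztig a ?_ h1]
  rw [tilde, Finset.mem_Icc] at h1 ⊢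
  rw [Finset.mem_Ico] at hi
  omega

/-! ### Stabilization -/

/-- `k = ℤ_{< lo} ∪ s`, with `s` contained in `ℤ_{≥ lo}`. -/
def IsCut (k : MayaZ) (lo : ℤ) (s : Finset ℤ) : Prop :=
  (∀ x ∈ s, lo ≤ x) ∧ ∀ x, x ∈ k.1 ↔ x < lo ∨ x ∈ s

theorem mem_res {I : FinInterval} {k : MayaZ} {x : ℤ} :
    x ∈ res I k ↔ (I.fst ≤ x ∧ x ≤ I.snd + 1) ∧ x ∈ k.1 := by
  classical
  rw [res, Finset.mem_filter, tilde, Finset.mem_Icc]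

theorem res_subset (I : FinInterval) (k : MayaZ) : res I k ⊆ tilde I := fun _ hx =>
  Finset.mem_Icc.2 (mem_res.1 hx).1

theorem IsCut.res_eq {k : MayaZ} {lo : ℤ} {s : Finset ℤ} (h : IsCut k lo s) {I : FinInterval}
    (hs : s ⊆ tilde I) (hlo : lo ≤ I.snd + 2) :
    res I k = Finset.Ico I.fst lo ∪ s := by
  ext x
  rw [mem_res, h.2, Finset.mem_union, Finset.mem_Ico]
  constructor
  · rintro ⟨h1, h2 | h2⟩
    · exact Or.inl ⟨h1.1, h2⟩
    · exact Or.inr h2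
  · rintro (h1 | h1)
    · exact ⟨by omega, Or.inl h1.2⟩
    · exact ⟨Finset.mem_Icc.1 (hs h1), Or.inr h1⟩

theorem IsCut.mem_MZ {k : MayaZ} {lo : ℤ} {s : Finset ℤ} (h : IsCut k lo s) {I : FinInterval}
    (hI : I.fst = lo) (hs : IsProperMaya I s) : k ∈ MZ I := by
  refine ⟨s, hs, ?_⟩
  ext x
  rw [h.2, Set.mem_union, Set.mem_Iic, Finset.mem_coe, hI]
  refine or_congr_left ?_
  omega

theorem IsCut.exists_isStabilizing (a : LusztigZ) {N : ℕ} (hN : 0 < N)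
    (ha : ∀ i j : ℤ, (N : ℤ) ≤ j - i → fullEntry a i j = 0) {k : MayaZ} {lo : ℤ}
    {s : Finset ℤ} (h : IsCut k lo s) (hs : Finset.Ico lo (lo + N) ⊆ s) :
    ∃ I, IsStabilizing a k I ∧ MAt a k I = mVal (fullEntry a) lo s := by
  obtain ⟨hi, hhi⟩ := s.bddAbove
  have hlo : lo ∈ s := hs (Finset.mem_Ico.2 ⟨le_rfl, by omega⟩)
  have hlohi : lo ≤ hi := hhi hlo
  -- Since `hi` bounds `s`, the extra point `hi + 1` of `tilde I` is missing from `s`, making `s`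
  -- proper.
  let I : FinInterval := ⟨(lo, hi), hlohi⟩
  have hsI : s ⊆ tilde I := fun x hx =>
    Finset.mem_Icc.2 ⟨h.1 x hx, (hhi hx).trans (Int.le_add_one le_rfl)⟩
  have hval : ∀ J : FinInterval, I ≤ J → MAt a k J = mVal (fullEntry a) lo s := by
    intro J hJ
    obtain ⟨h1, h2⟩ := NonemptyInterval.le_def.1 hJ
    have h1' : J.fst ≤ lo := h1
    have h2' : hi ≤ J.snd := h2
    have hsJ : s ⊆ tilde J := fun x hx => by
      have h3 := Finset.mem_Icc.1 (hsI hx)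
      have h4 : hi + 1 ≤ J.snd + 1 := by omega
      exact Finset.mem_Icc.2 ⟨h1'.trans h3.1, h3.2.trans h4⟩
    have hres := h.res_eq hsJ (by omega)
    rw [MAt, MFin_eq a J _ (res_subset J k), hres, mVal_extend _ ha lo s h.1 hs h1']
  refine ⟨I, ⟨h.mem_MZ rfl ⟨hsI, Finset.ne_empty_of_mem hlo, ?_⟩, fun J hJ => ?_⟩, hval I le_rfl⟩
  · intro heq
    have h1 : hi + 1 ∈ tilde I := by
      rw [tilde, Finset.mem_Icc]
      exact ⟨by change lo ≤ hi + 1; omega, le_rfl⟩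
    rw [← heq] at h1
    have := hhi h1
    omega
  · rw [hval J hJ, hval I le_rfl]

/-- Two stabilizing intervals give the same value on their join. -/
theorem PhiZ_eq_of_isStabilizing {a : LusztigZ} {k : MayaZ} {I : FinInterval}
    (h : IsStabilizing a k I) : PhiZ a k = MAt a k I := by
  have hex : ∃ I, IsStabilizing a k I := ⟨I, h⟩
  rw [PhiZ, dif_pos hex, ← hex.choose_spec.2 (hex.choose ⊔ I) le_sup_left,
    h.2 (hex.choose ⊔ I) le_sup_right]

theorem IsCut.PhiZ_eq (a : LusztigZ) {N : ℕ} (hN : 0 < N)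
    (ha : ∀ i j : ℤ, (N : ℤ) ≤ j - i → fullEntry a i j = 0) {k : MayaZ} {lo : ℤ}
    {s : Finset ℤ} (h : IsCut k lo s) (hs : Finset.Ico lo (lo + N) ⊆ s) :
    PhiZ a k = mVal (fullEntry a) lo s := by
  obtain ⟨I, hI, hval⟩ := h.exists_isStabilizing a hN ha hs
  rw [PhiZ_eq_of_isStabilizing hI, hval]

theorem exists_isCut (k : MayaZ) (N : ℕ) :
    ∃ lo s, IsCut k lo s ∧ Finset.Ico lo (lo + N) ⊆ s := by
  classical
  obtain ⟨α, β, hα, hβ⟩ := exists_bounds k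
  -- Cutting here keeps the `N` elements `α - N + 1, …, α` as the initial run.
  refine ⟨α - N + 1, (Finset.Icc (α - N + 1) (max α β)).filter (fun x => x ∈ k.1),
    ⟨fun x hx => ?_, fun x => ?_⟩, fun x hx => ?_⟩
  · exact (Finset.mem_Icc.1 (Finset.mem_filter.1 hx).1).1
  · rw [Finset.mem_filter, Finset.mem_Icc]
    constructor
    · intro hx
      have := Set.mem_Iic.1 (hβ hx)
      by_cases h : x < α - N + 1
      · exact Or.inl h
      · exact Or.inr ⟨⟨by omega, by omega⟩, hx⟩
    · rintro (hx | hx)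
      · exact hα (Set.mem_Iic.2 (by omega))
      · exact hx.2
  · rw [Finset.mem_Ico] at hx
    rw [Finset.mem_filter, Finset.mem_Icc]
    exact ⟨⟨by omega, by omega⟩, hα (Set.mem_Iic.2 (by omega))⟩

theorem isCut_ofRes (K : FinInterval) (N : ℕ) (s : Finset ℤ) (hs : ∀ x ∈ s, K.fst ≤ x) :
    IsCut (ofRes K s) (K.fst - N) (Finset.Ico (K.fst - N) K.fst ∪ s) := by
  refine ⟨fun x hx => ?_, fun x => ?_⟩
  · rcases Finset.mem_union.1 hx with hx | hx
    · exact (Finset.mem_Ico.1 hx).1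
    · have := hs x hx
      omega
  · rw [ofRes, Set.mem_union, Set.mem_Iic, Finset.mem_coe, Finset.mem_union, Finset.mem_Ico]
    by_cases hx : x ∈ s
    · simp [hx]
    · simp only [hx, or_false]
      omega

theorem PhiZ_ofRes (a : LusztigZ) {N : ℕ} (hN : 0 < N)
    (ha : ∀ i j : ℤ, (N : ℤ) ≤ j - i → fullEntry a i j = 0) (K : FinInterval) (s : Finset ℤ)
    (hs : ∀ x ∈ s, K.fst ≤ x) : PhiZ a (ofRes K s) =
      mVal (fullEntry a) (K.fst - N) (Finset.Ico (K.fst - N) K.fst ∪ s) := by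
  refine (isCut_ofRes K N s hs).PhiZ_eq a hN ha ?_
  rw [sub_add_cancel]
  exact Finset.subset_union_left

/-! ### The collections `M(a)` are `e`-BZ data -/

theorem isFinEBZ_restrictTo_PhiZ (a : LusztigZ) (K : FinInterval) :
    IsFinEBZ (restrictTo (PhiZ a) K) := by
  obtain ⟨N, hN, ha⟩ := exists_fullEntry_eq_zero a
  set T : Finset ℤ := Finset.Ico (K.fst - N) K.fst with hT
  have hge : ∀ s ⊆ tilde K, ∀ x ∈ s, K.fst ≤ x := fun s hs x hx =>
    (Finset.mem_Icc.1 (hs hx)).1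
  have hK : K.fst ≤ K.snd := K.fst_le_snd
  have hnot : ∀ s ⊆ tilde K, ∀ i ∈ tilde K, i ∉ s → i ∉ T ∪ s := by
    intro s _ i hi his
    rw [tilde, Finset.mem_Icc] at hi
    rw [Finset.mem_union, hT, Finset.mem_Ico]
    rintro (h | h)
    · omega
    · exact his h
  have hext : ∀ s ⊆ tilde K, ext0 (restrictTo (PhiZ a) K) s =
      mVal (fullEntry a) (K.fst - N) (T ∪ s) := by
    intro s hs
    by_cases h : IsProperMaya K s
    · rw [ext0, dif_pos h]
      exact PhiZ_ofRes a hN ha K s (hge s hs)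
    -- For `s = ∅` and `s = tilde K` the convention is consistent: `T ∪ s` is an interval, where
    -- `mVal` is zero.
    · rw [ext0, dif_neg h]
      by_cases h0 : s = ∅
      · rw [h0, Finset.union_empty, hT, mVal_Ico]
      · have h1 : s = tilde K := by
          by_contra h1
          exact h ⟨hs, h0, h1⟩
        have h2 : T ∪ s = Finset.Ico (K.fst - N) (K.snd + 2) := by
          rw [h1, hT]
          ext x
          simp only [tilde, Finset.mem_union, Finset.mem_Ico, Finset.mem_Icc]
          omega
        rw [h2, mVal_Ico]
  have hu1 : ∀ (s : Finset ℤ) (i : ℤ), T ∪ (s ∪ {i}) = insert i (T ∪ s) := by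
    intro s i
    ext x
    simp only [Finset.mem_union, Finset.mem_insert, Finset.mem_singleton]
    tauto
  have hu2 : ∀ (s : Finset ℤ) (i j : ℤ), T ∪ (s ∪ {i, j}) = insert i (insert j (T ∪ s)) := by
    intro s i j
    ext x
    simp only [Finset.mem_union, Finset.mem_insert, Finset.mem_singleton]
    tauto
  have sub1 : ∀ s ⊆ tilde K, ∀ i ∈ tilde K, s ∪ {i} ⊆ tilde K := fun s hs i hi =>
    Finset.union_subset hs (Finset.singleton_subset_iff.2 hi)
  have sub2 : ∀ s ⊆ tilde K, ∀ i ∈ tilde K, ∀ j ∈ tilde K, s ∪ {i, j} ⊆ tilde K :=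
    fun s hs i hi j hj => Finset.union_subset hs
      (Finset.insert_subset hi (Finset.singleton_subset_iff.2 hj))
  refine ⟨⟨?_, ?_⟩, ?_⟩
  · intro i hi j hj hij s hs his hjs
    rw [hext _ (sub1 s hs i hi), hext _ (sub1 s hs j hj), hext _ (sub2 s hs i hi j hj), hext s hs,
      hu1, hu1, hu2]
    exact mVal_edge _ _ _ hij (hnot s hs i hi his) (hnot s hs j hj hjs)
  · intro i hi j hj k hk hij hjk s hs his hjs hks
    rw [hext _ (sub1 s hs i hi), hext _ (sub1 s hs j hj), hext _ (sub1 s hs k hk),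
      hext _ (sub2 s hs i hi j hj), hext _ (sub2 s hs i hi k hk), hext _ (sub2 s hs j hj k hk),
      hu1, hu1, hu1, hu2, hu2, hu2]
    exact mVal_plucker _ _ _ hij hjk (hnot s hs i hi his) (hnot s hs j hj hjs) (hnot s hs k hk hks)
  · intro i hi hi'
    rw [hext _ fun x hx => by rw [tilde]; rw [Finset.mem_Icc] at hx ⊢; omega]
    have h2 : T ∪ Finset.Icc K.fst i = Finset.Ico (K.fst - N) (i + 1) := by
      rw [hT]
      ext x
      simp only [Finset.mem_union, Finset.mem_Ico, Finset.mem_Icc]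
      omega
    rw [h2, mVal_Ico]

/-- The complement in `J` consists of the holes of `k` up to `J.snd + 1`. Enlarging `J` to the left
only widens the gap below the holes; enlarging it to the right appends integers after a run of `N`
holes. Neither changes the value. -/
theorem exists_PhiZ_Omega_eq (a : LusztigZ) {l : ℕ}
    (hw : ∀ d, 0 < d → ∀ y : ℤ, ∃ s : ℕ, s < l ∧ diagWt (fullEntry a) d (y + s) = 0)
    (k : MayaZ) : ∃ I : FinInterval, k ∈ MZ I ∧
      ∀ J : FinInterval, I ≤ J → PhiZ a (Omega J k) = PhiZ a (Omega I k) := by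
  classical
  obtain ⟨N, hN, ha⟩ := exists_fullEntry_eq_zero a
  obtain ⟨α, β, hα, hβ⟩ := exists_bounds k
  -- The last `N` integers up to `m₀` exceed `β`, so they form a run of holes.
  set m₀ : ℤ := max α β + N with hm₀
  let B : ℤ → Finset ℤ := fun m => (Finset.Ioc α m).filter (fun x => x ∉ k.1)
  have hBmem : ∀ m x, x ∈ B m ↔ (α < x ∧ x ≤ m) ∧ x ∉ k.1 := fun m x => by
    simp only [B, Finset.mem_filter, Finset.mem_Ioc]
  have hkβ : ∀ x, β < x → x ∉ k.1 := fun x hx h => by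
    have := Set.mem_Iic.1 (hβ h)
    omega
  have hkα : ∀ x, x ≤ α → x ∈ k.1 := fun x hx => hα hx
  -- The gap depends only on the holes up to `m₀`. Later holes are removed by induction on `m`, so
  -- no wider gap is required.
  set g : ℤ := l * (N + (B m₀).card) with hg
  have hg0 : 0 ≤ g := by positivity
  set n₀ : ℤ := α - g with hn₀
  have hval : ∀ n m, n ≤ n₀ → m₀ ≤ m →
      mVal (fullEntry a) (n - N) (Finset.Ico (n - N) n ∪ B m) =
        -((∑ j ∈ B m₀, ∑ i ∈ Finset.Ico (j - N) j, fullEntry a i j : ℕ) : ℤ) +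
          setWt (diagWt (fullEntry a)) (B m₀) := by
    intro n m hn hm
    induction m, hm using Int.leInduction with
    | base =>
      refine mVal_Ico_union_of_gap (fullEntry a) ha hw n (B m₀) fun b hb => ?_
      rw [hBmem] at hb
      rw [← hg]
      omega
    | succ m hm ih =>
      have hB : Finset.Ico (n - N) n ∪ B (m + 1) =
          insert (m + 1) (Finset.Ico (n - N) n ∪ B m) := by
        ext x
        rw [Finset.mem_insert, Finset.mem_union, Finset.mem_union, hBmem, hBmem]
        by_cases hx : x = m + 1
        · have h1 := hkβ x (by omega)
          simp only [hx, true_or, iff_true]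
          subst hx
          exact Or.inr ⟨⟨by omega, le_rfl⟩, h1⟩
        · have h1 : x ≤ m + 1 ↔ x ≤ m := by omega
          rw [h1]
          simp only [hx, false_or]
      rw [hB, mVal_insert_right (fullEntry a) ha, ih]
      · intro j hj
        rcases Finset.mem_union.1 hj with hj | hj
        · have := Finset.mem_Ico.1 hj
          omega
        · rw [hBmem] at hj
          omega
      · intro x hx
        rw [Finset.mem_Ico] at hx
        refine Finset.mem_union_right _ ((hBmem _ _).2 ⟨⟨by omega, by omega⟩, hkβ x (by omega)⟩)
      · omega
  let I : FinInterval := ⟨(n₀, m₀), by change n₀ ≤ m₀; omega⟩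
  have hIf : I.fst = n₀ := rfl
  have hIs : I.snd = m₀ := rfl
  have hJ : ∀ J : FinInterval, I ≤ J → PhiZ a (Omega J k) =
      -((∑ j ∈ B m₀, ∑ i ∈ Finset.Ico (j - N) j, fullEntry a i j : ℕ) : ℤ) +
        setWt (diagWt (fullEntry a)) (B m₀) := by
    intro J hJ
    obtain ⟨h1, h2⟩ := NonemptyInterval.le_def.1 hJ
    rw [hIf] at h1
    rw [hIs] at h2
    have hB : tilde J \ res J k = B (J.snd + 1) := by
      ext x
      rw [Finset.mem_sdiff, mem_res, hBmem, tilde, Finset.mem_Icc]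
      constructor
      · rintro ⟨h3, h4⟩
        have h5 : x ∉ k.1 := fun h => h4 ⟨h3, h⟩
        refine ⟨⟨?_, h3.2⟩, h5⟩
        by_contra h6
        exact h5 (hkα x (by omega))
      · rintro ⟨h3, h4⟩
        exact ⟨⟨by omega, h3.2⟩, fun h => h4 h.2⟩
    rw [Omega, hB, PhiZ_ofRes a hN ha, hval J.fst (J.snd + 1) h1 (by omega)]
    intro x hx
    rw [hBmem] at hx
    omega
  refine ⟨I, ?_, fun J hIJ => by rw [hJ J hIJ, hJ I le_rfl]⟩
  have hcut : IsCut k n₀ (res I k) := by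
    refine ⟨fun x hx => ?_, fun x => ?_⟩
    · rw [mem_res, hIf] at hx
      exact hx.1.1
    · rw [mem_res, hIf, hIs]
      constructor
      · intro hx
        by_cases h : x < n₀
        · exact Or.inl h
        · refine Or.inr ⟨⟨by omega, ?_⟩, hx⟩
          have := Set.mem_Iic.1 (hβ hx)
          omega
      · rintro (hx | hx)
        · exact hkα x (by omega)
        · exact hx.2
  refine hcut.mem_MZ rfl ⟨res_subset I k, ?_, ?_⟩
  · refine Finset.ne_empty_of_mem (a := n₀) ?_
    rw [mem_res, hIf, hIs]
    exact ⟨⟨le_rfl, by omega⟩, hkα _ (by omega)⟩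
  · intro h
    have h1 : m₀ + 1 ∈ tilde I := by
      rw [tilde, Finset.mem_Icc, hIf, hIs]
      omega
    rw [← h, mem_res] at h1
    exact hkβ _ (by omega) h1.2

theorem PhiZ_shift (a : LusztigZ) (t : ℤ)
    (hper : ∀ i j, fullEntry a (i + t) (j + t) = fullEntry a i j) (k : MayaZ) :
    PhiZ a (shift t k) = PhiZ a k := by
  obtain ⟨N, hN, ha⟩ := exists_fullEntry_eq_zero a
  obtain ⟨lo, s, hcut, hs⟩ := exists_isCut k N
  have hcut' : IsCut (shift t k) (lo + t) (s.image (· + t)) := by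
    refine ⟨fun x hx => ?_, fun x => ?_⟩
    · obtain ⟨y, hy, rfl⟩ := Finset.mem_image.1 hx
      have := hcut.1 y hy
      omega
    · rw [Finset.mem_image]
      constructor
      · rintro ⟨y, hy, rfl⟩
        rcases (hcut.2 y).1 hy with h | h
        · exact Or.inl (by simpa using h)
        · exact Or.inr ⟨y, h, rfl⟩
      · rintro (h | ⟨y, hy, rfl⟩)
        · exact ⟨x - t, (hcut.2 _).2 (Or.inl (by omega)), by simp⟩
        · exact ⟨y, (hcut.2 _).2 (Or.inr hy), rfl⟩
  rw [hcut.PhiZ_eq a hN ha hs, hcut'.PhiZ_eq a hN ha, mVal_image_add _ t hper]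
  intro x hx
  rw [Finset.mem_Ico] at hx
  exact Finset.mem_image.2 ⟨x - t, hs (Finset.mem_Ico.2 ⟨by omega, by omega⟩), by simp⟩

/-! ### Periodic and aperiodic Lusztig data -/

theorem fullEntry_add_of_mem_BAff {l : ℕ} {a : LusztigZ} (ha : a ∈ BAff l) (i j : ℤ) :
    fullEntry a (i + l) (j + l) = fullEntry a i j := by
  by_cases h : i < j
  · rw [fullEntry_of_lt a h, fullEntry_of_lt a (by omega), ha i j h]
  · rw [fullEntry, fullEntry, dif_neg h, dif_neg (by omega)]

theorem fullEntry_add_mul_of_mem_BAff {l : ℕ} {a : LusztigZ} (ha : a ∈ BAff l) (n : ℤ)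
    (i j : ℤ) : fullEntry a (i + n * l) (j + n * l) = fullEntry a i j := by
  induction n with
  | zero => simp
  | succ n ih =>
    rw [← ih, ← fullEntry_add_of_mem_BAff ha (i + n * l)]
    congr 1 <;> ring
  | pred n ih =>
    rw [← ih, ← fullEntry_add_of_mem_BAff ha (i + (-n - 1) * l)]
    congr 1 <;> ring

theorem BAp_eq_BOfZ_zero {l : ℕ} (hl : 0 < l) : BAp l = BOfZ l 0 := by
  ext a
  refine and_congr_right fun ha => ⟨fun h => ?_, fun h i j hij => ?_⟩
  · funext n
    obtain ⟨s, -, hs⟩ := h 0 n (by exact_mod_cast n.pos)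
    exact Nat.sInf_eq_zero.2 (Or.inl ⟨⟨(0 + s, n + s), by simp⟩, by simp, hs.symm⟩)
  · obtain ⟨n, hn⟩ : ∃ n : ℕ+, (n : ℤ) = j - i :=
      ⟨⟨(j - i).toNat, by omega⟩, by simp; omega⟩
    rcases Nat.sInf_eq_zero.1 (congrFun h n) with ⟨⟨⟨i', j'⟩, hij'⟩, hd, h0⟩ | h0
    · simp only at hd hij'
      -- A zero anywhere on the diagonal moves by multiples of `l` into the window starting at `(i,
      -- j)`.
      refine ⟨((i' - i) % l).toNat, ?_, ?_⟩
      · have := Int.emod_lt_of_pos (i' - i) (show (0 : ℤ) < l by omega)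
        omega
      · have hmod := Int.emod_nonneg (i' - i) (show (l : ℤ) ≠ 0 by omega)
        have hdiv := Int.emod_add_mul_ediv (i' - i) l
        rw [← fullEntry_of_lt a (by simpa using hij),
          ← fullEntry_add_mul_of_mem_BAff ha ((i' - i) / l), Int.toNat_of_nonneg hmod]
        rw [← fullEntry_of_lt a hij'] at h0
        rw [h0]
        congr 1 <;> linarith
    -- The other way for `sInf` to vanish is an empty set, but the diagonal contains `(i, j)`.
    · have : a.1 ⟨(i, j), hij⟩ ∈ (∅ : Set ℕ) := by
        rw [← h0]
        exact ⟨⟨(i, j), hij⟩, hn.symm, rfl⟩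
      exact absurd this (Set.notMem_empty _)

theorem PhiZ_mem_BZeSigma {l : ℕ} {a : LusztigZ} (ha : a ∈ BAp l) : PhiZ a ∈ BZeSigma l := by
  refine ⟨⟨isFinEBZ_restrictTo_PhiZ a, exists_PhiZ_Omega_eq a (l := l) fun d hd y => ?_⟩, ?_⟩
  · obtain ⟨s, hs, h0⟩ := ha.2 y (y + d) (by omega)
    refine ⟨s, hs, ?_⟩
    rw [diagWt, add_right_comm, fullEntry_of_lt a (by omega), h0]
  · funext k
    refine PhiZ_shift a _ (fun i j => ?_) k
    rw [← fullEntry_add_of_mem_BAff ha.1 (i + -(l : ℤ)), neg_add_cancel_right,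
      neg_add_cancel_right]

end AffineBZ

theorem mainTheorem4 (l : ℕ) (hl : 3 ≤ l) :
    (∀ (a : AffineBZ.LusztigZ) (k : AffineBZ.MayaZ),
      (∃ I₀ : AffineBZ.FinInterval, AffineBZ.IsStabilizing a k I₀) ∧
      ∀ I₀ : AffineBZ.FinInterval, AffineBZ.IsStabilizing a k I₀ →
        AffineBZ.PhiZ a k = AffineBZ.MAt a k I₀) ∧
    AffineBZ.BAp l = AffineBZ.BOfZ l 0 ∧
    Set.MapsTo AffineBZ.PhiZ (AffineBZ.BAp l) AffineBZ.BZe ∧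
    Set.MapsTo AffineBZ.PhiZ (AffineBZ.BAp l) (AffineBZ.BZeSigma l) := by
  refine ⟨fun a k => ⟨?_, fun I hI => AffineBZ.PhiZ_eq_of_isStabilizing hI⟩,
    AffineBZ.BAp_eq_BOfZ_zero (by omega), fun a ha => (AffineBZ.PhiZ_mem_BZeSigma ha).1,
    fun a ha => AffineBZ.PhiZ_mem_BZeSigma ha⟩
  obtain ⟨N, hN, ha⟩ := AffineBZ.exists_fullEntry_eq_zero a
  obtain ⟨lo, s, hcut, hs⟩ := AffineBZ.exists_isCut k N
  obtain ⟨I, hI, -⟩ := hcut.exists_isStabilizing a hN ha hs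
  exact ⟨I, hI⟩
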